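/- **Setting.** Formulas over a set $AP$ are in positive normal form: $\phi ::= p \mid \neg p \mid \phi\wedge\phi \mid \phi\vee\phi \mid \phi\,\mathbf U_{\bowtie n}\phi \mid \phi\,\mathbf R_{\bowtie n}\phi \mid \mathbf F_{\bowtie n}\phi \mid \mathbf G_{\bowtie n}\phi$ with $\bowtie\in\{<,\le,\ge,>\}$, $n\in\mathbb N$; $\mathbf F_{\bowtie n}\phi$ means $\mathrm{true}\,\mathbf U_{\bowtie n}\phi$, $\mathbf G_{\bowtie n}\phi$ means $\mathrm{false}\,\mathbf R_{\bowtie n}\phi$, $\mathbf U=\mathbf U_{\ge0}$, $\mathbf R=\mathbf R_{\ge 0}$. A super-dense timed trace $\sigma=\langle I_0,v_0\rangle\langle I_1,v_1\rangle\dots$ has $v_i\subseteq AP$ and bounded intervals $I_i$ covering $[0,\infty)$, each a singleton $[T,T]$ or open $(T,T')$, with $I_0=[0,0]$; $(T,T')$ is followed by $[T',T']$, and $[T,T]$ by $[T,T]$ or some $(T,T'')$. Its points are the pairs $(i,t)$ with $t\in I_i$, ordered lexicographically by a strict order $\prec$. Literals and connectives are evaluated at $(i,t)$ using $v_i$; $(i,t)\models\alpha\mathbf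 U_{\bowtie n}\beta$ iff there is a point $(j,u)\succ(i,t)$ with $u-t\bowtie n$, $(j,u)\models\beta$, and $\alpha$ at all points strictly between; $(i,t)\models\alpha\mathbf R_{\bowtie n}\beta$ iff for each point $(j,u)\succ(i,t)$ with $u-t\bowtie n$ and $(j,u)\not\models\beta$ there is a point strictly between at which $\alpha$ holds. $\sigma$ is $\phi$-fine if no subformula of $\phi$ changes its truth value within an interval $I_i$. A transition system $S=\langle Z,X,\mathcal I,\mathcal{INV},\mathcal T,\mathcal F,\widehat{AP}\rangle$ has finite sets $Z$ of typed non-clock and $X$ of non-negative real clock variables, quantifier-free formulas $\mathcal I,\mathcal{INV}$ over $Z\cup X$ and $\mathcal T$ over $Z\cup X\cup\{\delta\}\cup Z'\cup X'$, finitely many fairness formulas over $Z$, and a formula $\hat p$ over $Z$ for each $p\in AP$; an atom either concerns only $Z\cup Z'$, or is $x'=0$, $x'=x+\delta$, $x\bowtie n$, $x+\delta\bowtie n$ or $\delta\bowtie n$ (with $\bowtie\in\{<,\le,=,\ge,>\}$, $n \in \mathbb N$); and $\mathcal T$ implies $\delta\ge0$ and $x'\in\{0,x+\delta\}$ for each clock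 $x$. A run is a sequence of states $s_0\xrightarrow{\delta_0}s_1\xrightarrow{\delta_1}\cdots$ with $\delta_0=0$, $\delta_i\ge0$, $\delta_i>0\Rightarrow\delta_{i+1}=0$, $s_0\models\mathcal I$, all $s_i\models\mathcal{INV}$, all steps satisfying $\mathcal T$, and every fairness formula true infinitely often. With $t_i=\sum_{j<i}\delta_j$, its trace has $v_i=\{p: s_i\models\hat p\}$ and $I_i=[t_i,t_i]$ if $\delta_i=0$, $I_i=(t_i,t_i+\delta_i)$ if $\delta_i>0$. Only non-zeno runs are considered. **Encodings.** Let $S$ be a transition system. A system $S'$ obtained from $S$ by adding variables, conjuncts to $\mathcal I$ and $\mathcal T$, and fairness formulas *encodes* $\phi$ if it has a Boolean variable $[\![\psi]\!]$ for each subformula $\psi$ of $\phi$. For a set $\Phi$ of encoded formulas, $S'$ is a *complete encoding of $\Phi$* if each trace $\sigma$ of $S$ that is $\phi$-fine for all $\phi\in\Phi$ is the trace of a run $s_0s_1\dots$ of $S'$ such that, for all $\phi\in\Phi$ and all points $(i,t)$ of $\sigma$, if $\phi$ holds at $(i,t)$ then $s_i([\![\phi]\!])$ is true; it is a complete encoding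 of $\phi$ if it is one of $\{\phi\}$. Write $o$ for the variable $[\![\phi]\!]$ of the formula $\phi$ being encoded, $l,r$ for those of its left and right operands ($r$ for a single operand), $y'$ for next-state values, $op$ for $\delta>0$. The system $S'_\phi$ extends $S'$ by $o$, by fresh Boolean variables among $ob,lo,ro$, by a fresh clock $c$ if needed, and by the following conjuncts of $\mathcal T$. (As $\mathcal T$ may not mention $\delta'$, the next-state conditions $op'$ and $T'$ are expressed through fresh Boolean variables forced by $\mathcal T$ to equal $op$ and $T$.) - $p$: $o\Leftrightarrow\hat p$; $\neg p$: $o\Leftrightarrow\neg\hat p$; $\wedge$: $o\Leftrightarrow l\wedge r$; $\vee$: $o\Leftrightarrow l\vee r$. - $l\,\mathbf U\,r$: $o\wedge op\Rightarrow l\wedge(r\vee r'\vee(l'\wedge o'))$; $o\wedge\neg op\Rightarrow(\neg op'\wedge r')\vee(l'\wedge o')$; fairness $\neg o\vee r$. - $\mathbf F_{\le0}r$: $o\Rightarrow\neg op\wedge\neg op'\wedge(r'\vee o')$. - $\mathbf F_{<n}r,\mathbf F_{\le n}r$ ($n>0$): initially $c=0\wedge\neg lo$; $o\wedge op\Rightarrow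 r\vee r'\vee o'$; $o\wedge\neg op\Rightarrow r'\vee o'$; with $R=(\neg o\vee(op\wedge r)\vee r')\wedge o'$: $R\Rightarrow c'=0\wedge(lo'\Leftrightarrow op')$, $\neg R\Rightarrow c'=c+\delta\wedge(lo'\Leftrightarrow lo)$; $o\wedge\neg(r\wedge op)\Rightarrow T$, where $T$ is $c+\delta<n\vee(lo\wedge c+\delta\le n)$ for $<$ and $c+\delta<n\vee((\neg op'\vee lo)\wedge c+\delta\le n)$ for $\le$. - $l\,\mathbf U_{\ge n}r$ ($n>0$), $l\,\mathbf U_{>n}r$ ($n\ge0$): with $T$ equal to $c+\delta>n\vee((ro\vee\neg op)\wedge c+\delta\ge n)$ for $\ge$ and $c+\delta>n\vee(ro\wedge c+\delta\ge n)$ for $>$, and $\hat r=r\wedge T$: $o\Rightarrow ob$; if $n>0$, $o\Rightarrow ob'\wedge l'$; $ob\wedge op\Rightarrow l\wedge(\hat r\vee\hat r'\vee(l'\wedge ob'))$; $ob\wedge\neg op\Rightarrow(\neg op'\wedge\hat r')\vee(l'\wedge ob')$; $o\Rightarrow c'=0\wedge(ro'\Leftrightarrow op)$; $\neg o\Rightarrow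 c'=c+\delta\wedge(ro'\Leftrightarrow ro)$; fairness $\neg ob\vee r$. - $l\,\mathbf R\,r$: $o\wedge op\Rightarrow ob$; $o\wedge\neg op\Rightarrow ob'$; $ob\Rightarrow l\vee ob'$; $ob\Rightarrow(op\wedge l)\vee r$. - $\mathbf G_{\le0}r$: $o\Rightarrow op\vee op'\vee(r'\wedge o')$. - $\mathbf G_{<n}r,\mathbf G_{\le n}r$ ($n>0$): $(o\wedge op)\vee T\Rightarrow r$; $o\Rightarrow c'=0\wedge(ro'\Leftrightarrow op)$; $\neg o\Rightarrow c'=c+\delta\wedge(ro'\Leftrightarrow ro)$; $T$ is $c<n$ for $<$ and $c<n\vee(c\le n\wedge\neg op\wedge\neg ro)$ for $\le$. - $l\,\mathbf R_{\ge n}r$ ($n>0$), $l\,\mathbf R_{>n}r$ ($n\ge0$): initially $c=0\wedge\neg lo$; the first three conjuncts for $l\,\mathbf R\,r$; $ob\wedge T\Rightarrow(l\wedge op)\vee r$; $o\wedge\delta>n\Rightarrow l\vee r$; with $D=\neg op\wedge ob\wedge l\wedge o$ and $R=o'\wedge(\neg ob\vee l)\wedge(op\vee\neg o)$: $D\Rightarrow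 c'=0\wedge\neg lo'$, $R\Rightarrow c'=0\wedge(lo'\Leftrightarrow op')$, $\neg R\wedge\neg D\Rightarrow c'=c+\delta\wedge(lo'\Leftrightarrow lo)$; $T$ is $c+\delta>n\vee(\neg lo\wedge\neg op\wedge c+\delta\ge n)$ for $\ge$ and $c+\delta>n$ for $>$. **Lemma (completeness of the encodings).** Let $S$ be a transition system over $AP$. For each $p \in AP$, $S_p$ is a complete encoding of $p$ and $S_{\neg p}$ is a complete encoding of $\neg p$. If an extension $S'$ of $S$ is a complete encoding of $\{\alpha\}$, then $S'_{\mathrm{Op}\,\alpha}$ is a complete encoding of $\mathrm{Op}\,\alpha$ for each $\mathrm{Op}\in\{\mathbf F_{\le0},\mathbf F_{<n},\mathbf F_{\le n},\mathbf G_{\le0},\mathbf G_{<n},\mathbf G_{\le n}\}$ ($n>0$). If $S'$ is a complete encoding of $\{\alpha,\beta\}$, then $S'_{\alpha\,\mathrm{Op}\,\beta}$ is a complete encoding of $\alpha\,\mathrm{Op}\,\beta$ for each $\mathrm{Op}\in\{\wedge,\vee,\mathbf U,\mathbf U_{\ge n},\mathbf U_{>m},\mathbf R,\mathbf R_{\ge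 n},\mathbf R_{>m}\}$ ($n>0$, $m\ge0$). More generally, if $S'$ is a complete encoding of a set $\Phi$, and $\phi$ is a literal, or $\mathrm{Op}\,\alpha$ or $\alpha\,\mathrm{Op}\,\beta$ with $\alpha,\beta\in\Phi$ and $\mathrm{Op}$ as above, then $S'_\phi$ is a complete encoding of $\Phi\cup\{\phi\}$. -/

import Mathlib

universe u

/-! ## Formulas of the logic, in positive normal form -/

/-- The comparisons that may occur in the time bound of a temporal operator. -/
inductive TimeRel
  | lt | le | ge | gt

/-- `r.Holds d n` : the real number `d` satisfies `d ⋈ n`. -/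
def TimeRel.Holds : TimeRel → ℝ → ℕ → Prop
  | .lt, d, n => d < n
  | .le, d, n => d ≤ n
  | .ge, d, n => d ≥ n
  | .gt, d, n => d > n

/-- `MITL_{0,∞}` formulas in positive normal form. The literals `p` and `¬p` are the atomic
formulas. `ev r n φ` is `F_{⋈ n} φ`, i.e. `true U_{⋈ n} φ`, and `alw r n φ` is `G_{⋈ n} φ`, i.e.
`false R_{⋈ n} φ`. All temporal operators are strict. -/
inductive MITL (AP : Type u) : Type u
  | atom (p : AP)
  | natom (p : AP)
  | and (φ ψ : MITL AP)
  | or (φ ψ : MITL AP)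
  | untl (r : TimeRel) (n : ℕ) (φ ψ : MITL AP)
  | release (r : TimeRel) (n : ℕ) (φ ψ : MITL AP)
  | ev (r : TimeRel) (n : ℕ) (φ : MITL AP)
  | alw (r : TimeRel) (n : ℕ) (φ : MITL AP)

/-- The set of subformulas, including the formula itself. -/
def MITL.sub {AP : Type u} : MITL AP → Set (MITL AP)
  | .atom p => {.atom p}
  | .natom p => {.natom p}
  | .and φ ψ => insert (.and φ ψ) (φ.sub ∪ ψ.sub)
  | .or φ ψ => insert (.or φ ψ) (φ.sub ∪ ψ.sub)
  | .untl r n φ ψ => insert (.untl r n φ ψ) (φ.sub ∪ ψ.sub)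
  | .release r n φ ψ => insert (.release r n φ ψ) (φ.sub ∪ ψ.sub)
  | .ev r n φ => insert (.ev r n φ) φ.sub
  | .alw r n φ => insert (.alw r n φ) φ.sub

/-! ## Super-dense timed traces -/

/-- A super-dense timed trace. The `i`-th interval is the singleton `[lo i, lo i]` if
`lo i = hi i`, and the open interval `(lo i, hi i)` if `lo i < hi i`. -/
structure SDTrace (AP : Type u) where
  lo : ℕ → ℝ
  hi : ℕ → ℝ
  val : ℕ → Set AP
  lo_nonneg : ∀ i, 0 ≤ lo i
  lo_le_hi : ∀ i, lo i ≤ hi i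
  lo_zero : lo 0 = 0
  hi_zero : hi 0 = 0
  /-- consecutive intervals are adjacent -/
  lo_succ : ∀ i, lo (i + 1) = hi i
  /-- an open interval is followed by a singleton -/
  open_succ : ∀ i, lo i < hi i → hi (i + 1) = lo (i + 1)
  /-- every time point lies in some interval (non-zenoness) -/
  covers : ∀ t : ℝ, 0 ≤ t →
    ∃ i, (lo i = hi i ∧ t = lo i) ∨ (lo i < hi i ∧ t ∈ Set.Ioo (lo i) (hi i))

namespace SDTrace

variable {AP : Type u}

/-- The `i`-th interval, as a set of time points. -/
def interval (σ : SDTrace AP) (i : ℕ) : Set ℝ :=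
  {t | (σ.lo i = σ.hi i ∧ t = σ.lo i) ∨ (σ.lo i < σ.hi i ∧ t ∈ Set.Ioo (σ.lo i) (σ.hi i))}

/-- The strict order on pairs (index, time). -/
def Earlier (i : ℕ) (t : ℝ) (j : ℕ) (u : ℝ) : Prop :=
  i < j ∨ (i = j ∧ t < u)

/-- Semantics of `A U_{⋈ n} B` at the point `(i, t)`. -/
def UntilAt (σ : SDTrace AP) (r : TimeRel) (n : ℕ) (A B : ℕ → ℝ → Prop) (i : ℕ) (t : ℝ) : Prop :=
  ∃ (j : ℕ) (u : ℝ), u ∈ σ.interval j ∧ Earlier i t j u ∧ r.Holds (u - t) n ∧ B j u ∧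
    ∀ (k : ℕ) (w : ℝ), w ∈ σ.interval k → Earlier i t k w → Earlier k w j u → A k w

/-- Semantics of `A R_{⋈ n} B` at the point `(i, t)`. -/
def ReleaseAt (σ : SDTrace AP) (r : TimeRel) (n : ℕ) (A B : ℕ → ℝ → Prop) (i : ℕ) (t : ℝ) :
    Prop :=
  ∀ (j : ℕ) (u : ℝ), u ∈ σ.interval j → Earlier i t j u → r.Holds (u - t) n ∧ ¬ B j u →
    ∃ (k : ℕ) (w : ℝ), w ∈ σ.interval k ∧ Earlier i t k w ∧ Earlier k w j u ∧ A k w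

/-- `σ.Sat φ i t` : the formula `φ` holds at the point `(i, t)` of `σ`. -/
def Sat (σ : SDTrace AP) : MITL AP → ℕ → ℝ → Prop
  | .atom p, i, _ => p ∈ σ.val i
  | .natom p, i, _ => p ∉ σ.val i
  | .and φ ψ, i, t => σ.Sat φ i t ∧ σ.Sat ψ i t
  | .or φ ψ, i, t => σ.Sat φ i t ∨ σ.Sat ψ i t
  | .untl r n φ ψ, i, t => σ.UntilAt r n (σ.Sat φ) (σ.Sat ψ) i t
  | .release r n φ ψ, i, t => σ.ReleaseAt r n (σ.Sat φ) (σ.Sat ψ) i t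
  | .ev r n φ, i, t => σ.UntilAt r n (fun _ _ => True) (σ.Sat φ) i t
  | .alw r n φ, i, t => σ.ReleaseAt r n (fun _ _ => False) (σ.Sat φ) i t

/-- `σ` is `φ`-fine: no subformula of `φ` changes its value within an interval of `σ`. -/
def Fine (σ : SDTrace AP) (φ : MITL AP) : Prop :=
  ∀ ψ ∈ φ.sub, ∀ i, ∀ t ∈ σ.interval i, ∀ u ∈ σ.interval i, σ.Sat ψ i t ↔ σ.Sat ψ i u

end SDTrace

/-! ## Quantifier-free formulas over non-clock variables, clocks and a duration -/

/-- Boolean combinations of atoms. -/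
inductive BForm (A : Type*)
  | tru
  | lit (a : A)
  | not (f : BForm A)
  | and (f g : BForm A)
  | or (f g : BForm A)
  | imp (f g : BForm A)
  | iff (f g : BForm A)

prefix:max "∼" => BForm.not
infixr:35 " ⋏ " => BForm.and
infixr:30 " ⋎ " => BForm.or
infixr:25 " ⟶ₑ " => BForm.imp
infix:20 " ⟷ₑ " => BForm.iff

namespace BForm

variable {A B : Type*}

def eval (v : A → Prop) : BForm A → Prop
  | tru => True
  | lit a => v a
  | not f => ¬ f.eval v
  | and f g => f.eval v ∧ g.eval v
  | or f g => f.eval v ∨ g.eval v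
  | imp f g => f.eval v → g.eval v
  | iff f g => (f.eval v ↔ g.eval v)

def map (h : A → B) : BForm A → BForm B
  | tru => tru
  | lit a => lit (h a)
  | not f => not (f.map h)
  | and f g => and (f.map h) (g.map h)
  | or f g => or (f.map h) (g.map h)
  | imp f g => imp (f.map h) (g.map h)
  | iff f g => iff (f.map h) (g.map h)

def conj : List (BForm A) → BForm A
  | [] => tru
  | f :: l => and f (conj l)

theorem eval_map (h : A → B) (v : B → Prop) (f : BForm A) :
    (f.map h).eval v ↔ f.eval (fun a => v (h a)) := by
  induction f with
  | tru => exact Iff.rfl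
  | lit a => exact Iff.rfl
  | not f ih => simp [map, eval, ih]
  | and f g ihf ihg => simp [map, eval, ihf, ihg]
  | or f g ihf ihg => simp [map, eval, ihf, ihg]
  | imp f g ihf ihg => simp [map, eval, ihf, ihg]
  | iff f g ihf ihg => simp [map, eval, ihf, ihg]

end BForm

/-- The comparisons that may occur in clock atoms. -/
inductive ClockRel
  | lt | le | eq | ge | gt

def ClockRel.Holds : ClockRel → ℝ → ℕ → Prop
  | .lt, d, n => d < n
  | .le, d, n => d ≤ n
  | .eq, d, n => d = n
  | .ge, d, n => d ≥ n
  | .gt, d, n => d > n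

/-- A valuation of typed variables: every variable `z` gets a value in its domain `dom z`. -/
abbrev Val {Z : Type} (dom : Z → Type) : Type := ∀ z, dom z

/-- A valuation of the non-clock variables and of the real-valued clock variables. -/
structure State {Z : Type} (dom : Z → Type) (X : Type) where
  disc : Val dom
  clk : X → ℝ

/-- Clock variables have non-negative values. -/
def State.Nonneg {Z : Type} {dom : Z → Type} {X : Type} (s : State dom X) : Prop :=
  ∀ x, 0 ≤ s.clk x

/-- Atoms over the non-clock variables and clocks: either an arbitrary atom of the background
theory over non-clock variables only, or `x ⋈ n`. -/
inductive StateAtom {Z : Type} (dom : Z → Type) (X : Type) : Type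
  | disc (P : Val dom → Prop)
  | clock (x : X) (r : ClockRel) (n : ℕ)

/-- Atoms over non-clock variables, clocks, the duration `δ`, and the next-state versions of the
variables: an arbitrary atom of the background theory over current and next non-clock variables
only, or one of `x' = 0`, `x' = x + δ`, `x ⋈ n`, `x + δ ⋈ n`, `δ ⋈ n`. -/
inductive TransAtom {Z : Type} (dom : Z → Type) (X : Type) : Type
  | disc (P : Val dom → Val dom → Prop)
  | reset (x : X)
  | advance (x : X)
  | clock (x : X) (r : ClockRel) (n : ℕ)
  | elapsed (x : X) (r : ClockRel) (n : ℕ)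
  | dur (r : ClockRel) (n : ℕ)

abbrev StateFormula {Z : Type} (dom : Z → Type) (X : Type) : Type := BForm (StateAtom dom X)

abbrev TransFormula {Z : Type} (dom : Z → Type) (X : Type) : Type := BForm (TransAtom dom X)

section Eval

variable {Z : Type} {dom : Z → Type} {X : Type}

def StateAtom.eval (s : State dom X) : StateAtom dom X → Prop
  | .disc P => P s.disc
  | .clock x r n => r.Holds (s.clk x) n

def TransAtom.eval (s : State dom X) (δ : ℝ) (s' : State dom X) : TransAtom dom X → Prop
  | .disc P => P s.disc s'.disc
  | .reset x => s'.clk x = 0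
  | .advance x => s'.clk x = s.clk x + δ
  | .clock x r n => r.Holds (s.clk x) n
  | .elapsed x r n => r.Holds (s.clk x + δ) n
  | .dur r n => r.Holds δ n

/-- `s ⊨ f`. -/
def State.Sat (s : State dom X) (f : StateFormula dom X) : Prop :=
  f.eval (StateAtom.eval s)

/-- `f` is true when the current variables have the values `s`, the duration variable the value
`δ` and the next-state variables the values `s'`. -/
def TransSat (s : State dom X) (δ : ℝ) (s' : State dom X) (f : TransFormula dom X) : Prop :=
  f.eval (TransAtom.eval s δ s')

end Eval

/-! ## Symbolic transition systems with clock-like variables -/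

/-- A symbolic transition system with clock-like variables over `AP`. Fairness formulas and the
formulas of the atomic propositions speak about non-clock variables only, hence are arbitrary
predicates of their valuations. -/
structure TransitionSystem (AP : Type u) where
  Z : Type
  dom : Z → Type
  X : Type
  finite_Z : Finite Z
  finite_X : Finite X
  init : StateFormula dom X
  inv : StateFormula dom X
  trans : TransFormula dom X
  fair : List (Val dom → Prop)
  ap : AP → Val dom → Prop
  /-- time never runs backwards, and a clock either is reset or advances with time -/
  clocks : ∀ (s : State dom X) (δ : ℝ) (s' : State dom X), s.Nonneg → s'.Nonneg →
    TransSat s δ s' trans → 0 ≤ δ ∧ ∀ x, s'.clk x = 0 ∨ s'.clk x = s.clk x + δ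

namespace TransitionSystem

variable {AP : Type u}

/-- A run `s₀ →δ₀ s₁ →δ₁ s₂ …`. -/
structure Run (S : TransitionSystem AP) where
  state : ℕ → State S.dom S.X
  dur : ℕ → ℝ
  dur_zero : dur 0 = 0
  dur_nonneg : ∀ i, 0 ≤ dur i
  clk_nonneg : ∀ i, (state i).Nonneg
  dur_succ : ∀ i, 0 < dur i → dur (i + 1) = 0
  init : (state 0).Sat S.init
  inv : ∀ i, (state i).Sat S.inv
  trans : ∀ i, TransSat (state i) (dur i) (state (i + 1)) S.trans
  fair : ∀ f ∈ S.fair, ∀ m, ∃ i, m ≤ i ∧ f (state i).disc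

/-- `trace(τ) = σ`. As every time point is covered by `σ`, such a run is non-zeno. -/
def Run.HasTrace {S : TransitionSystem AP} (τ : S.Run) (σ : SDTrace AP) : Prop :=
  ∀ i, σ.val i = {p | S.ap p (τ.state i).disc} ∧
    σ.lo i = ∑ j ∈ Finset.range i, τ.dur j ∧ σ.hi i = σ.lo i + τ.dur i

/-- The set of traces of (the non-zeno runs of) a system. -/
def traces (S : TransitionSystem AP) : Set (SDTrace AP) :=
  {σ | ∃ τ : S.Run, τ.HasTrace σ}

end TransitionSystem

/-! ## Extending a system by new variables and constraints -/

section Lift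

variable {Z N : Type} {dom : Z → Type} {ndom : N → Type} {X NX : Type}

/-- The valuation of the old non-clock variables. -/
def Val.old (v : Val (Sum.elim dom ndom)) : Val dom := fun z => v (Sum.inl z)

/-- The valuation of the old variables. -/
def State.old (s : State (Sum.elim dom ndom) (X ⊕ NX)) : State dom X :=
  ⟨Val.old s.disc, fun x => s.clk (Sum.inl x)⟩

/-- A formula over the old variables, read as a formula over all variables. -/
def StateFormula.lift (ndom : N → Type) (NX : Type) (f : StateFormula dom X) :
    StateFormula (Sum.elim dom ndom) (X ⊕ NX) :=
  f.map fun
    | .disc P => .disc fun v => P (Val.old v)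
    | .clock x r n => .clock (Sum.inl x) r n

/-- A formula over the old variables, read as a formula over all variables. -/
def TransFormula.lift (ndom : N → Type) (NX : Type) (f : TransFormula dom X) :
    TransFormula (Sum.elim dom ndom) (X ⊕ NX) :=
  f.map fun
    | .disc P => .disc fun v v' => P (Val.old v) (Val.old v')
    | .reset x => .reset (Sum.inl x)
    | .advance x => .advance (Sum.inl x)
    | .clock x r n => .clock (Sum.inl x) r n
    | .elapsed x r n => .elapsed (Sum.inl x) r n
    | .dur r n => .dur r n

theorem TransSat_lift (s : State (Sum.elim dom ndom) (X ⊕ NX)) (δ : ℝ)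
    (s' : State (Sum.elim dom ndom) (X ⊕ NX)) (f : TransFormula dom X) :
    TransSat s δ s' (f.lift ndom NX) ↔ TransSat s.old δ s'.old f := by
  unfold TransSat TransFormula.lift
  rw [BForm.eval_map]
  have h : (fun a : TransAtom dom X => TransAtom.eval s δ s' (match a with
      | .disc P => .disc fun v v' => P (Val.old v) (Val.old v')
      | .reset x => .reset (Sum.inl x)
      | .advance x => .advance (Sum.inl x)
      | .clock x r n => .clock (Sum.inl x) r n
      | .elapsed x r n => .elapsed (Sum.inl x) r n
      | .dur r n => .dur r n)) = TransAtom.eval s.old δ s'.old := by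
    funext a
    cases a <;> rfl
  exact iff_of_eq (congrArg (fun w => BForm.eval w f) h)

theorem StateSat_lift (s : State (Sum.elim dom ndom) (X ⊕ NX)) (f : StateFormula dom X) :
    s.Sat (f.lift ndom NX) ↔ s.old.Sat f := by
  unfold State.Sat StateFormula.lift
  rw [BForm.eval_map]
  have h : (fun a : StateAtom dom X => StateAtom.eval s (match a with
      | .disc P => .disc fun v => P (Val.old v)
      | .clock x r n => .clock (Sum.inl x) r n)) = StateAtom.eval s.old := by
    funext a
    cases a <;> rfl
  exact iff_of_eq (congrArg (fun w => BForm.eval w f) h)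

end Lift

namespace TransitionSystem

variable {AP : Type u}

/-- New variables `Z_φ`, `X_φ`, and new conjuncts `I_φ`, `T_φ` and fairness formulas `F_φ`, over
the old and the new variables. -/
structure Increment (S : TransitionSystem AP) where
  Z : Type
  dom : Z → Type
  X : Type
  finite_Z : Finite Z
  finite_X : Finite X
  init : StateFormula (Sum.elim S.dom dom) (S.X ⊕ X)
  trans : TransFormula (Sum.elim S.dom dom) (S.X ⊕ X)
  fair : List (Val (Sum.elim S.dom dom) → Prop)
  clocks : ∀ (s : State (Sum.elim S.dom dom) (S.X ⊕ X)) (δ : ℝ)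
    (s' : State (Sum.elim S.dom dom) (S.X ⊕ X)), s.Nonneg → s'.Nonneg →
    TransSat s.old δ s'.old S.trans → TransSat s δ s' trans →
    ∀ x : X, s'.clk (Sum.inr x) = 0 ∨ s'.clk (Sum.inr x) = s.clk (Sum.inr x) + δ

/-- The system `⟨Z ∪ Z_φ, X ∪ X_φ, I ∧ I_φ, INV, T ∧ T_φ, F ∪ F_φ, AP⟩`. -/
def extend (S : TransitionSystem AP) (N : S.Increment) : TransitionSystem AP where
  Z := S.Z ⊕ N.Z
  dom := Sum.elim S.dom N.dom
  X := S.X ⊕ N.X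
  finite_Z := by
    have := S.finite_Z
    have := N.finite_Z
    infer_instance
  finite_X := by
    have := S.finite_X
    have := N.finite_X
    infer_instance
  init := S.init.lift N.dom N.X ⋏ N.init
  inv := S.inv.lift N.dom N.X
  trans := S.trans.lift N.dom N.X ⋏ N.trans
  fair := S.fair.map (fun f v => f (Val.old v)) ++ N.fair
  ap := fun p v => S.ap p (Val.old v)
  clocks := by
    rintro s δ s' hs hs' ⟨h1, h2⟩
    have h1' := (TransSat_lift s δ s' S.trans).1 h1
    obtain ⟨hδ, hx⟩ := S.clocks s.old δ s'.old (fun x => hs _) (fun x => hs' _) h1'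
    refine ⟨hδ, ?_⟩
    rintro (x | x)
    · exact hx x
    · exact N.clocks s δ s' hs hs' h1' h2 x

/-- `S'` is obtained from `S` by adding variables and constraints (in finitely many steps). -/
inductive Extends (S : TransitionSystem AP) : TransitionSystem AP → Prop
  | refl : Extends S S
  | step {S' : TransitionSystem AP} (h : Extends S S') (N : S'.Increment) :
      Extends S (S'.extend N)

end TransitionSystem

/-- A Boolean non-clock variable. -/
structure BoolVar {Z : Type} (dom : Z → Type) where
  var : Z
  isBool : dom var = Bool

namespace BoolVar

variable {Z : Type} {dom : Z → Type}

/-- The variable has the value true. -/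
def IsTrue (b : BoolVar dom) (v : Val dom) : Prop :=
  cast b.isBool (v b.var) = true

/-- An old Boolean variable, as a variable of an extended system. -/
def lift {N : Type} (ndom : N → Type) (b : BoolVar dom) : BoolVar (Sum.elim dom ndom) :=
  ⟨Sum.inl b.var, b.isBool⟩

/-- A new Boolean variable. -/
def new {N : Type} (a : N) : BoolVar (Sum.elim dom (fun _ : N => Bool)) :=
  ⟨Sum.inr a, rfl⟩

end BoolVar

/-- An encoding over the system `S`: a system `sys` that extends `S`, and a Boolean variable `⟦φ⟧`
of `sys` for each formula `φ` of a subformula-closed set. It encodes `φ` if `φ` is in this set. -/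
structure Encoding {AP : Type u} (S : TransitionSystem AP) where
  sys : TransitionSystem AP
  isExtension : S.Extends sys
  formulas : Set (MITL AP)
  closed : ∀ φ ∈ formulas, φ.sub ⊆ formulas
  enc : ∀ φ, φ ∈ formulas → BoolVar sys.dom

/-- The system `S` itself, encoding no formula. -/
def Encoding.base {AP : Type u} (S : TransitionSystem AP) : Encoding S where
  sys := S
  isExtension := .refl
  formulas := ∅
  closed := fun _ h => h.elim
  enc := fun _ h => h.elim

/-- Completeness of an encoding, jointly for all formulas in `Φ`: all of them are encoded, and each
trace of `S` that is fine for all of them is the trace of a run of the extended system in which,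
for every `φ` in `Φ`, the variable `⟦φ⟧` is true on each interval with a point where `φ` holds.
`E.CompleteFor {φ}` says that `E` is a complete encoding of `φ`. -/
def Encoding.CompleteFor {AP : Type u} {S : TransitionSystem AP} (E : Encoding S)
    (Φ : Set (MITL AP)) : Prop :=
  ∃ hΦ : Φ ⊆ E.formulas, ∀ σ ∈ S.traces, (∀ φ ∈ Φ, σ.Fine φ) →
    ∃ τ : E.sys.Run, τ.HasTrace σ ∧
      ∀ φ (hφ : φ ∈ Φ) (i : ℕ), ∀ t ∈ σ.interval i, σ.Sat φ i t →
        (E.enc φ (hΦ hφ)).IsTrue (τ.state i).disc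

/-! ## Encoding constraints of the operators -/

namespace Constraints

variable {Z : Type} {dom : Z → Type} {X : Type}

/-- The current value of a Boolean variable. -/
def now (b : BoolVar dom) : TransFormula dom X := .lit (.disc fun v _ => b.IsTrue v)

/-- The next-state value of a Boolean variable. -/
def nxt (b : BoolVar dom) : TransFormula dom X := .lit (.disc fun _ v' => b.IsTrue v')

/-- `x' = 0` -/
def reset (x : X) : TransFormula dom X := .lit (.reset x)

/-- `x' = x + δ` -/
def advance (x : X) : TransFormula dom X := .lit (.advance x)

/-- `x ⋈ n` -/
def clock (x : X) (r : ClockRel) (n : ℕ) : TransFormula dom X := .lit (.clock x r n)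

/-- `x + δ ⋈ n` -/
def elapsed (x : X) (r : ClockRel) (n : ℕ) : TransFormula dom X := .lit (.elapsed x r n)

/-- `δ > n` -/
def durGt (n : ℕ) : TransFormula dom X := .lit (.dur .gt n)

/-- The current interval is open: `δ > 0`. -/
def isOpen : TransFormula dom X := durGt 0

/-- `x = 0 ∧ ¬ b`, as a condition on the initial state. -/
def initZero (x : X) (b : BoolVar dom) : StateFormula dom X :=
  .lit (.clock x .eq 0) ⋏ ∼(.lit (.disc fun v => b.IsTrue v))

/-! In what follows `out` is the variable of the encoded formula, and `l`, `r` are the variables of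
its operands. The transition formula must not speak about `δ'`. As usual, this is circumvented by a
Boolean variable `opn` that is forced to equal `δ > 0`, so that its next-state version `opn'` says
that the next interval is open. -/

/-- `l U r`. -/
def untl (out l r opn : BoolVar dom) : TransFormula dom X := .conj [
  now opn ⟷ₑ isOpen,
  now out ⋏ isOpen ⟶ₑ now l ⋏ (now r ⋎ nxt r ⋎ (nxt l ⋏ nxt out)),
  now out ⋏ ∼isOpen ⟶ₑ (∼(nxt opn) ⋏ nxt r) ⋎ (nxt l ⋏ nxt out)]

/-- `F_{≤ 0} r`. -/
def evZero (out r opn : BoolVar dom) : TransFormula dom X := .conj [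
  now opn ⟷ₑ isOpen,
  now out ⟶ₑ ∼isOpen ⋏ ∼(nxt opn) ⋏ (nxt r ⋎ nxt out)]

/-- The timing condition of `F_{< n} r`. -/
def evLtTiming (n : ℕ) (lefto : BoolVar dom) (c : X) : TransFormula dom X :=
  elapsed c .lt n ⋎ (now lefto ⋏ elapsed c .le n)

/-- The timing condition of `F_{≤ n} r`. -/
def evLeTiming (n : ℕ) (lefto opn : BoolVar dom) (c : X) : TransFormula dom X :=
  elapsed c .lt n ⋎ ((∼(nxt opn) ⋎ now lefto) ⋏ elapsed c .le n)

/-- The reset condition of `F_{◁ n} r`. -/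
def evReset (out r : BoolVar dom) : TransFormula dom X :=
  (∼(now out) ⋎ (isOpen ⋏ now r) ⋎ nxt r) ⋏ nxt out

/-- `F_{◁ n} r` with timing condition `T`. -/
def ev (T : TransFormula dom X) (out r lefto opn : BoolVar dom) (c : X) : TransFormula dom X :=
  .conj [
  now opn ⟷ₑ isOpen,
  now out ⋏ isOpen ⟶ₑ now r ⋎ nxt r ⋎ nxt out,
  now out ⋏ ∼isOpen ⟶ₑ nxt r ⋎ nxt out,
  evReset out r ⟶ₑ reset c ⋏ (nxt lefto ⟷ₑ nxt opn),
  ∼(evReset out r) ⟶ₑ advance c ⋏ (nxt lefto ⟷ₑ now lefto),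
  now out ⋏ ∼(now r ⋏ isOpen) ⟶ₑ T]

/-- The timing condition of `l U_{> n} r`. -/
def untlGtTiming (n : ℕ) (righto : BoolVar dom) (c : X) : TransFormula dom X :=
  elapsed c .gt n ⋎ (now righto ⋏ elapsed c .ge n)

/-- The timing condition of `l U_{≥ n} r`. -/
def untlGeTiming (n : ℕ) (righto : BoolVar dom) (c : X) : TransFormula dom X :=
  elapsed c .gt n ⋎ ((now righto ⋎ ∼isOpen) ⋏ elapsed c .ge n)

/-- `l U_{▷ n} r` with timing condition `T`. The variable `tim` is forced to equal `T`, for the same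
reason as `opn` is forced to equal `δ > 0`; so `r̂ = r ∧ tim` and `r̂' = r' ∧ tim'`. -/
def untlLower (T : TransFormula dom X) (n : ℕ) (out l r oblig righto opn tim : BoolVar dom)
    (c : X) : TransFormula dom X := .conj [
  now opn ⟷ₑ isOpen,
  now tim ⟷ₑ T,
  now out ⟶ₑ now oblig,
  if 0 < n then now out ⟶ₑ nxt oblig ⋏ nxt l else .tru,
  now oblig ⋏ isOpen ⟶ₑ
    now l ⋏ ((now r ⋏ now tim) ⋎ (nxt r ⋏ nxt tim) ⋎ (nxt l ⋏ nxt oblig)),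
  now oblig ⋏ ∼isOpen ⟶ₑ (∼(nxt opn) ⋏ (nxt r ⋏ nxt tim)) ⋎ (nxt l ⋏ nxt oblig),
  now out ⟶ₑ reset c ⋏ (nxt righto ⟷ₑ isOpen),
  ∼(now out) ⟶ₑ advance c ⋏ (nxt righto ⟷ₑ now righto)]

/-- `l R r`. -/
def release (out l r oblig : BoolVar dom) : TransFormula dom X := .conj [
  now out ⋏ isOpen ⟶ₑ now oblig,
  now out ⋏ ∼isOpen ⟶ₑ nxt oblig,
  now oblig ⟶ₑ now l ⋎ nxt oblig,
  now oblig ⟶ₑ (isOpen ⋏ now l) ⋎ now r]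

/-- `G_{≤ 0} r`. -/
def alwZero (out r opn : BoolVar dom) : TransFormula dom X := .conj [
  now opn ⟷ₑ isOpen,
  now out ⟶ₑ isOpen ⋎ nxt opn ⋎ (nxt r ⋏ nxt out)]

/-- The timing condition of `G_{< n} r`. -/
def alwLtTiming (n : ℕ) (c : X) : TransFormula dom X := clock c .lt n

/-- The timing condition of `G_{≤ n} r`. -/
def alwLeTiming (n : ℕ) (righto : BoolVar dom) (c : X) : TransFormula dom X :=
  clock c .lt n ⋎ (clock c .le n ⋏ ∼isOpen ⋏ ∼(now righto))

/-- `G_{◁ n} r` with timing condition `T`. -/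
def alw (T : TransFormula dom X) (out r righto : BoolVar dom) (c : X) : TransFormula dom X :=
  .conj [
  (now out ⋏ isOpen) ⋎ T ⟶ₑ now r,
  now out ⟶ₑ reset c ⋏ (nxt righto ⟷ₑ isOpen),
  ∼(now out) ⟶ₑ advance c ⋏ (nxt righto ⟷ₑ now righto)]

/-- The timing condition of `l R_{> n} r`. -/
def releaseGtTiming (n : ℕ) (c : X) : TransFormula dom X := elapsed c .gt n

/-- The timing condition of `l R_{≥ n} r`. -/
def releaseGeTiming (n : ℕ) (lefto : BoolVar dom) (c : X) : TransFormula dom X :=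
  elapsed c .gt n ⋎ (∼(now lefto) ⋏ ∼isOpen ⋏ elapsed c .ge n)

/-- The condition for a delayed reset in the encoding of `l R_{▷ n} r`. -/
def releaseDelay (out l oblig : BoolVar dom) : TransFormula dom X :=
  ∼isOpen ⋏ now oblig ⋏ now l ⋏ now out

/-- The reset condition of `l R_{▷ n} r`. -/
def releaseReset (out l oblig : BoolVar dom) : TransFormula dom X :=
  nxt out ⋏ (∼(now oblig) ⋎ now l) ⋏ (isOpen ⋎ ∼(now out))

/-- `l R_{▷ n} r` with timing condition `T`. -/
def releaseLower (T : TransFormula dom X) (n : ℕ) (out l r oblig lefto opn : BoolVar dom)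
    (c : X) : TransFormula dom X := .conj [
  now opn ⟷ₑ isOpen,
  now out ⋏ isOpen ⟶ₑ now oblig,
  now out ⋏ ∼isOpen ⟶ₑ nxt oblig,
  now oblig ⟶ₑ now l ⋎ nxt oblig,
  now oblig ⋏ T ⟶ₑ (now l ⋏ isOpen) ⋎ now r,
  now out ⋏ durGt n ⟶ₑ now l ⋎ now r,
  releaseDelay out l oblig ⟶ₑ reset c ⋏ ∼(nxt lefto),
  releaseReset out l oblig ⟶ₑ reset c ⋏ (nxt lefto ⟷ₑ nxt opn),
  ∼(releaseReset out l oblig) ⋏ ∼(releaseDelay out l oblig) ⟶ₑ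
    advance c ⋏ (nxt lefto ⟷ₑ now lefto)]

end Constraints

/-! ## The new variables of the encodings -/

/-- Names for the Boolean variables that the encodings introduce. -/
inductive Aux
  | out | oblig | lefto | righto | opn | tim
  deriving DecidableEq

/-- The new Boolean variables of an encoding whose auxiliary variables are those in `A`. -/
abbrev AuxVars (A : Finset Aux) : Type := {a : Aux // a ∈ A}

namespace TransitionSystem

variable {AP : Type u} {S : TransitionSystem AP}

/-- An increment with the new Boolean variables in `A` and no new clock. -/
def boolIncrement (S : TransitionSystem AP) (A : Finset Aux)
    (trans : TransFormula (Sum.elim S.dom (fun _ : AuxVars A => Bool)) (S.X ⊕ Empty))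
    (fair : List (Val (Sum.elim S.dom (fun _ : AuxVars A => Bool)) → Prop)) : S.Increment where
  Z := AuxVars A
  dom := fun _ => Bool
  X := Empty
  finite_Z := inferInstance
  finite_X := inferInstance
  init := .tru
  trans := trans
  fair := fair
  clocks := fun _ _ _ _ _ _ _ x => x.elim

/-- An increment with the new Boolean variables in `A` and one new clock. -/
def clockIncrement (S : TransitionSystem AP) (A : Finset Aux)
    (init : StateFormula (Sum.elim S.dom (fun _ : AuxVars A => Bool)) (S.X ⊕ Unit))
    (trans : TransFormula (Sum.elim S.dom (fun _ : AuxVars A => Bool)) (S.X ⊕ Unit))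
    (fair : List (Val (Sum.elim S.dom (fun _ : AuxVars A => Bool)) → Prop))
    (clocks : ∀ (s : State (Sum.elim S.dom (fun _ : AuxVars A => Bool)) (S.X ⊕ Unit)) (δ : ℝ)
      (s' : State (Sum.elim S.dom (fun _ : AuxVars A => Bool)) (S.X ⊕ Unit)),
      TransSat s δ s' trans →
      s'.clk (Sum.inr ()) = 0 ∨ s'.clk (Sum.inr ()) = s.clk (Sum.inr ()) + δ) :
    S.Increment where
  Z := AuxVars A
  dom := fun _ => Bool
  X := Unit
  finite_Z := inferInstance
  finite_X := inferInstance
  init := init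
  trans := trans
  fair := fair
  clocks := fun s δ s' _ _ _ h _ => clocks s δ s' h

end TransitionSystem

namespace Constraints

variable {Z : Type} {dom : Z → Type} {X : Type}

theorem ev_clock {T : TransFormula dom X} {out r lefto opn : BoolVar dom} {c : X}
    (s : State dom X) (δ : ℝ) (s' : State dom X) (h : TransSat s δ s' (ev T out r lefto opn c)) :
    s'.clk c = 0 ∨ s'.clk c = s.clk c + δ := by
  obtain ⟨-, -, -, h1, h2, -⟩ := h
  by_cases hR : (evReset out r).eval (TransAtom.eval s δ s')
  · exact Or.inl (h1 hR).1
  · exact Or.inr (h2 hR).1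

theorem untlLower_clock {T : TransFormula dom X} {n : ℕ}
    {out l r oblig righto opn tim : BoolVar dom} {c : X}
    (s : State dom X) (δ : ℝ) (s' : State dom X)
    (h : TransSat s δ s' (untlLower T n out l r oblig righto opn tim c)) :
    s'.clk c = 0 ∨ s'.clk c = s.clk c + δ := by
  obtain ⟨-, -, -, -, -, -, h1, h2, -⟩ := h
  by_cases hR : (now out).eval (TransAtom.eval s δ s')
  · exact Or.inl (h1 hR).1
  · exact Or.inr (h2 hR).1

theorem alw_clock {T : TransFormula dom X} {out r righto : BoolVar dom} {c : X}
    (s : State dom X) (δ : ℝ) (s' : State dom X) (h : TransSat s δ s' (alw T out r righto c)) :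
    s'.clk c = 0 ∨ s'.clk c = s.clk c + δ := by
  obtain ⟨-, h1, h2, -⟩ := h
  by_cases hR : (now out).eval (TransAtom.eval s δ s')
  · exact Or.inl (h1 hR).1
  · exact Or.inr (h2 hR).1

theorem releaseLower_clock {T : TransFormula dom X} {n : ℕ}
    {out l r oblig lefto opn : BoolVar dom} {c : X}
    (s : State dom X) (δ : ℝ) (s' : State dom X)
    (h : TransSat s δ s' (releaseLower T n out l r oblig lefto opn c)) :
    s'.clk c = 0 ∨ s'.clk c = s.clk c + δ := by
  obtain ⟨-, -, -, -, -, -, h1, h2, h3, -⟩ := h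
  by_cases hD : (releaseDelay out l oblig).eval (TransAtom.eval s δ s')
  · exact Or.inl (h1 hD).1
  by_cases hR : (releaseReset out l oblig).eval (TransAtom.eval s δ s')
  · exact Or.inl (h2 hR).1
  · exact Or.inr (h3 ⟨hR, hD⟩).1

end Constraints

/-! ## The encodings -/

/-- The unary operators that are encoded. -/
inductive UnOp
  | evLeZero
  | evLt (n : ℕ) (hn : 0 < n)
  | evLe (n : ℕ) (hn : 0 < n)
  | alwLeZero
  | alwLt (n : ℕ) (hn : 0 < n)
  | alwLe (n : ℕ) (hn : 0 < n)

/-- The formula `Op α`. -/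
def UnOp.apply {AP : Type u} : UnOp → MITL AP → MITL AP
  | .evLeZero, α => .ev .le 0 α
  | .evLt n _, α => .ev .lt n α
  | .evLe n _, α => .ev .le n α
  | .alwLeZero, α => .alw .le 0 α
  | .alwLt n _, α => .alw .lt n α
  | .alwLe n _, α => .alw .le n α

/-- The binary operators that are encoded. Here `until` and `release` are the untimed operators
`U = U_{≥ 0}` and `R = R_{≥ 0}`. -/
inductive BinOp
  | and
  | or
  | until
  | untilGe (n : ℕ) (hn : 0 < n)
  | untilGt (n : ℕ)
  | release
  | releaseGe (n : ℕ) (hn : 0 < n)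
  | releaseGt (n : ℕ)

/-- The formula `α Op β`. -/
def BinOp.apply {AP : Type u} : BinOp → MITL AP → MITL AP → MITL AP
  | .and, α, β => .and α β
  | .or, α, β => .or α β
  | .until, α, β => .untl .ge 0 α β
  | .untilGe n _, α, β => .untl .ge n α β
  | .untilGt n, α, β => .untl .gt n α β
  | .release, α, β => .release .ge 0 α β
  | .releaseGe n _, α, β => .release .ge n α β
  | .releaseGt n, α, β => .release .gt n α β

/-- A new Boolean variable of an encoding. -/
def BoolVar.aux {Z : Type} {dom : Z → Type} {A : Finset Aux} (a : Aux) (h : a ∈ A) :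
    BoolVar (Sum.elim dom (fun _ : AuxVars A => Bool)) :=
  BoolVar.new ⟨a, h⟩

/-- An operand's variable, as a variable of the extended system. -/
def BoolVar.operand {Z : Type} {dom : Z → Type} {A : Finset Aux} (b : BoolVar dom) :
    BoolVar (Sum.elim dom (fun _ : AuxVars A => Bool)) :=
  b.lift _

namespace TransitionSystem

variable {AP : Type u}

open Constraints

/-- The increment for the literal `p`: `⟦p⟧ ↔ p̂`. -/
def atomIncrement (S : TransitionSystem AP) (p : AP) : S.Increment :=
  S.boolIncrement {.out}
    (now (.aux .out (by decide)) ⟷ₑ .lit (.disc fun v _ => S.ap p (Val.old v))) []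

/-- The increment for the literal `¬p`: `⟦¬p⟧ ↔ ¬p̂`. -/
def natomIncrement (S : TransitionSystem AP) (p : AP) : S.Increment :=
  S.boolIncrement {.out}
    (now (.aux .out (by decide)) ⟷ₑ ∼(.lit (.disc fun v _ => S.ap p (Val.old v)))) []

end TransitionSystem

/-- The increment that encodes `Op r`, where `r` is the variable of the operand. -/
def UnOp.increment {AP : Type u} (S : TransitionSystem AP) (r : BoolVar S.dom) :
    UnOp → S.Increment
  | .evLeZero => S.boolIncrement {.out, .opn}
      (Constraints.evZero (.aux .out (by decide)) r.operand (.aux .opn (by decide))) []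
  | .evLt n _ => S.clockIncrement {.out, .lefto, .opn}
      (Constraints.initZero (.inr ()) (.aux .lefto (by decide)))
      (Constraints.ev (Constraints.evLtTiming n (.aux .lefto (by decide)) (.inr ()))
        (.aux .out (by decide)) r.operand (.aux .lefto (by decide)) (.aux .opn (by decide))
        (.inr ()))
      [] Constraints.ev_clock
  | .evLe n _ => S.clockIncrement {.out, .lefto, .opn}
      (Constraints.initZero (.inr ()) (.aux .lefto (by decide)))
      (Constraints.ev
        (Constraints.evLeTiming n (.aux .lefto (by decide)) (.aux .opn (by decide)) (.inr ()))
        (.aux .out (by decide)) r.operand (.aux .lefto (by decide)) (.aux .opn (by decide))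
        (.inr ()))
      [] Constraints.ev_clock
  | .alwLeZero => S.boolIncrement {.out, .opn}
      (Constraints.alwZero (.aux .out (by decide)) r.operand (.aux .opn (by decide))) []
  | .alwLt n _ => S.clockIncrement {.out, .righto} .tru
      (Constraints.alw (Constraints.alwLtTiming n (.inr ()))
        (.aux .out (by decide)) r.operand (.aux .righto (by decide)) (.inr ()))
      [] Constraints.alw_clock
  | .alwLe n _ => S.clockIncrement {.out, .righto} .tru
      (Constraints.alw (Constraints.alwLeTiming n (.aux .righto (by decide)) (.inr ()))
        (.aux .out (by decide)) r.operand (.aux .righto (by decide)) (.inr ()))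
      [] Constraints.alw_clock

/-- The increment that encodes `l Op r`, where `l`, `r` are the variables of the operands. The
fairness formula is `¬⟦l U r⟧ ∨ r` for the untimed until operator and `¬oblig ∨ r` for the until
operators with a lower time bound. -/
def BinOp.increment {AP : Type u} (S : TransitionSystem AP) (l r : BoolVar S.dom) :
    BinOp → S.Increment
  | .and => S.boolIncrement {.out}
      (Constraints.now (.aux .out (by decide)) ⟷ₑ
        Constraints.now l.operand ⋏ Constraints.now r.operand) []
  | .or => S.boolIncrement {.out}
      (Constraints.now (.aux .out (by decide)) ⟷ₑ
        Constraints.now l.operand ⋎ Constraints.now r.operand) []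
  | .until => S.boolIncrement {.out, .opn}
      (Constraints.untl (.aux .out (by decide)) l.operand r.operand (.aux .opn (by decide)))
      [fun v => ¬ (BoolVar.aux .out (by decide)).IsTrue v ∨ r.operand.IsTrue v]
  | .untilGe n _ => S.clockIncrement {.out, .oblig, .righto, .opn, .tim} .tru
      (Constraints.untlLower (Constraints.untlGeTiming n (.aux .righto (by decide)) (.inr ())) n
        (.aux .out (by decide)) l.operand r.operand (.aux .oblig (by decide))
        (.aux .righto (by decide)) (.aux .opn (by decide)) (.aux .tim (by decide)) (.inr ()))
      [fun v => ¬ (BoolVar.aux .oblig (by decide)).IsTrue v ∨ r.operand.IsTrue v]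
      Constraints.untlLower_clock
  | .untilGt n => S.clockIncrement {.out, .oblig, .righto, .opn, .tim} .tru
      (Constraints.untlLower (Constraints.untlGtTiming n (.aux .righto (by decide)) (.inr ())) n
        (.aux .out (by decide)) l.operand r.operand (.aux .oblig (by decide))
        (.aux .righto (by decide)) (.aux .opn (by decide)) (.aux .tim (by decide)) (.inr ()))
      [fun v => ¬ (BoolVar.aux .oblig (by decide)).IsTrue v ∨ r.operand.IsTrue v]
      Constraints.untlLower_clock
  | .release => S.boolIncrement {.out, .oblig}
      (Constraints.release (.aux .out (by decide)) l.operand r.operand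
        (.aux .oblig (by decide))) []
  | .releaseGe n _ => S.clockIncrement {.out, .oblig, .lefto, .opn}
      (Constraints.initZero (.inr ()) (.aux .lefto (by decide)))
      (Constraints.releaseLower
        (Constraints.releaseGeTiming n (.aux .lefto (by decide)) (.inr ())) n
        (.aux .out (by decide)) l.operand r.operand (.aux .oblig (by decide))
        (.aux .lefto (by decide)) (.aux .opn (by decide)) (.inr ()))
      [] Constraints.releaseLower_clock
  | .releaseGt n => S.clockIncrement {.out, .oblig, .lefto, .opn}
      (Constraints.initZero (.inr ()) (.aux .lefto (by decide)))
      (Constraints.releaseLower (Constraints.releaseGtTiming n (.inr ())) n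
        (.aux .out (by decide)) l.operand r.operand (.aux .oblig (by decide))
        (.aux .lefto (by decide)) (.aux .opn (by decide)) (.inr ()))
      [] Constraints.releaseLower_clock

/-- The variable `⟦Op α⟧`. -/
def UnOp.out {AP : Type u} (S : TransitionSystem AP) (r : BoolVar S.dom) (o : UnOp) :
    BoolVar (Sum.elim S.dom (o.increment S r).dom) :=
  match o with
  | .evLeZero | .evLt _ _ | .evLe _ _ | .alwLeZero | .alwLt _ _ | .alwLe _ _ =>
    BoolVar.aux .out (by decide)

/-- The variable `⟦α Op β⟧`. -/
def BinOp.out {AP : Type u} (S : TransitionSystem AP) (l r : BoolVar S.dom) (o : BinOp) :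
    BoolVar (Sum.elim S.dom (o.increment S l r).dom) :=
  match o with
  | .and | .or | .until | .untilGe _ _ | .untilGt _ | .release | .releaseGe _ _ | .releaseGt _ =>
    BoolVar.aux .out (by decide)

namespace Encoding

variable {AP : Type u} {S : TransitionSystem AP}

open Classical in
/-- Extend an encoding by an increment with the variable `out` for `φ`. -/
noncomputable def add (E : Encoding S) (φ : MITL AP) (N : E.sys.Increment)
    (out : BoolVar (Sum.elim E.sys.dom N.dom)) (hφ : φ.sub ⊆ insert φ E.formulas) :
    Encoding S where
  sys := E.sys.extend N
  isExtension := E.isExtension.step N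
  formulas := insert φ E.formulas
  closed := by
    rintro ψ (rfl | hψ)
    · exact hφ
    · exact (E.closed ψ hψ).trans (Set.subset_insert _ _)
  enc := fun ψ hψ =>
    if h : ψ = φ then out else (E.enc ψ (hψ.resolve_left h)).lift N.dom

/-- `S_p` -/
noncomputable def addAtom (E : Encoding S) (p : AP) : Encoding S :=
  E.add (.atom p) (E.sys.atomIncrement p) (.aux .out (by decide))
    (by rintro ψ rfl; exact Or.inl rfl)

/-- `S_{¬p}` -/
noncomputable def addNatom (E : Encoding S) (p : AP) : Encoding S :=
  E.add (.natom p) (E.sys.natomIncrement p) (.aux .out (by decide))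
    (by rintro ψ rfl; exact Or.inl rfl)

/-- `S_{Op α}`, for a system that encodes `α`. -/
noncomputable def addUn (E : Encoding S) (o : UnOp) (α : MITL AP) (hα : α ∈ E.formulas) :
    Encoding S :=
  E.add (o.apply α) (o.increment E.sys (E.enc α hα)) (o.out E.sys (E.enc α hα)) (by
    cases o <;> exact Set.insert_subset_insert (E.closed α hα))

/-- `S_{α Op β}`, for a system that encodes `α` and `β`. -/
noncomputable def addBin (E : Encoding S) (o : BinOp) (α β : MITL AP) (hα : α ∈ E.formulas)
    (hβ : β ∈ E.formulas) : Encoding S :=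
  E.add (o.apply α β) (o.increment E.sys (E.enc α hα) (E.enc β hβ))
    (o.out E.sys (E.enc α hα) (E.enc β hβ)) (by
    cases o <;>
      exact Set.insert_subset_insert (Set.union_subset (E.closed α hα) (E.closed β hβ)))

end Encoding

/-! Completeness needs variables that are true at least where their formulas hold, so a run of the
given system can be kept and only values for the new variables have to be supplied. For a temporal
operator the output variable is the truth value of the formula on each interval, which is well
defined because the trace is fine. The point semantics then turns into statements about interval
indices, where the only trace of density is that open intervals have points arbitrarily close to
both ends but do not attain them.

Resets determine the clock and its flag recursively. What has to be found is an invariant, preserved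
from each index to the next, saying that the obligation measured by the clock is really met by the
trace. For upper-bounded eventually and lower-bounded until, the invariant carries an interval that
discharges the obligation. All points of an open interval can share one such interval (`ev_witness`,
`until_witness`), with the bound possibly reached only in the limit; the flag records exactly this.
For always and lower-bounded release, the invariant says that every demand the clock will make later
is satisfied or released. The results are `ev_exists`, `untilLower_exists`, `alw_exists` and
`releaseLower_exists`; the untimed and zero-bounded operators need no clock.

Operand variables may be true more often than the operands hold. Where they occur positively in a
constraint this does no harm. The exceptions are the reset conditions of eventually and of
lower-bounded release, whose lemmas are therefore proved for an arbitrary overapproximation of the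
operand. The equivalences for conjunction and disjunction are met by letting the output follow the
operand variables.

`CompleteFor.add` turns such values into a run of the extended system, which gives the joint
statement. The statements for exactly the operands follow by `CompleteFor.anti`, since fineness for
a formula includes fineness for its operands. -/

namespace SDTrace

/-! ### Intervals of a trace and their points -/

variable {AP : Type u} (σ : SDTrace AP)

/-- The `i`-th interval is open. -/
def IsOpen (i : ℕ) : Prop := σ.lo i < σ.hi i

variable {σ}

theorem lo_le_lo {i j : ℕ} (h : i ≤ j) : σ.lo i ≤ σ.lo j := by
  induction j, h using Nat.le_induction with
  | base => exact le_rfl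
  | succ j _ ih => exact ih.trans ((σ.lo_le_hi j).trans (σ.lo_succ j).ge)

theorem hi_le_lo {i j : ℕ} (h : i < j) : σ.hi i ≤ σ.lo j :=
  (σ.lo_succ i).ge.trans (lo_le_lo h)

theorem hi_le_hi {i j : ℕ} (h : i ≤ j) : σ.hi i ≤ σ.hi j := by
  rcases h.eq_or_lt with rfl | h
  · exact le_rfl
  · exact (hi_le_lo h).trans (σ.lo_le_hi j)

theorem hi_eq_lo {i : ℕ} (h : ¬ σ.IsOpen i) : σ.hi i = σ.lo i :=
  le_antisymm (not_lt.1 h) (σ.lo_le_hi i)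

theorem mem_interval_of_open {i : ℕ} (h : σ.IsOpen i) {t : ℝ} :
    t ∈ σ.interval i ↔ σ.lo i < t ∧ t < σ.hi i :=
  ⟨fun ht => ht.elim (fun e => absurd e.1 (ne_of_lt h)) fun e => e.2, fun ht => Or.inr ⟨h, ht⟩⟩

theorem mem_interval_of_not_open {i : ℕ} (h : ¬ σ.IsOpen i) {t : ℝ} :
    t ∈ σ.interval i ↔ t = σ.lo i :=
  ⟨fun ht => ht.elim (fun e => e.2) fun e => absurd e.1 h, fun ht => Or.inl ⟨(hi_eq_lo h).symm, ht⟩⟩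

theorem lo_le_of_mem {i : ℕ} {t : ℝ} (h : t ∈ σ.interval i) : σ.lo i ≤ t := by
  by_cases ho : σ.IsOpen i
  · exact ((mem_interval_of_open ho).1 h).1.le
  · exact ((mem_interval_of_not_open ho).1 h).ge

theorem le_hi_of_mem {i : ℕ} {t : ℝ} (h : t ∈ σ.interval i) : t ≤ σ.hi i := by
  by_cases ho : σ.IsOpen i
  · exact ((mem_interval_of_open ho).1 h).2.le
  · exact ((mem_interval_of_not_open ho).1 h).trans_le (σ.lo_le_hi i)

theorem lo_lt_of_mem {i : ℕ} {t : ℝ} (ho : σ.IsOpen i) (h : t ∈ σ.interval i) : σ.lo i < t :=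
  ((mem_interval_of_open ho).1 h).1

theorem lt_hi_of_mem {i : ℕ} {t : ℝ} (ho : σ.IsOpen i) (h : t ∈ σ.interval i) : t < σ.hi i :=
  ((mem_interval_of_open ho).1 h).2

theorem isOpen_of_lt {i : ℕ} {t u : ℝ} (ht : t ∈ σ.interval i) (hu : u ∈ σ.interval i)
    (h : t < u) : σ.IsOpen i :=
  (lo_le_of_mem ht).trans_lt (h.trans_le (le_hi_of_mem hu))

/-- The interval has points arbitrarily close to its left end. -/
theorem exists_mem_lt (i : ℕ) {x : ℝ} (h : σ.lo i < x) : ∃ t ∈ σ.interval i, t < x := by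
  by_cases ho : σ.IsOpen i
  · obtain ⟨t, h1, h2⟩ := exists_between (lt_min ho h)
    exact ⟨t, (mem_interval_of_open ho).2 ⟨h1, h2.trans_le (min_le_left _ _)⟩,
      h2.trans_le (min_le_right _ _)⟩
  · exact ⟨σ.lo i, (mem_interval_of_not_open ho).2 rfl, h⟩

/-- The interval has points arbitrarily close to its right end. -/
theorem exists_mem_gt (i : ℕ) {x : ℝ} (h : x < σ.hi i) : ∃ t ∈ σ.interval i, x < t := by
  by_cases ho : σ.IsOpen i
  · obtain ⟨t, h1, h2⟩ := exists_between (max_lt ho h)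
    exact ⟨t, (mem_interval_of_open ho).2 ⟨(le_max_left _ _).trans_lt h1, h2⟩,
      (le_max_right _ _).trans_lt h1⟩
  · exact ⟨σ.lo i, (mem_interval_of_not_open ho).2 rfl, hi_eq_lo ho ▸ h⟩

theorem interval_nonempty (i : ℕ) : ∃ t, t ∈ σ.interval i :=
  (exists_mem_lt i (lt_add_one (σ.lo i))).imp fun _ h => h.1

/-- Non-zenoness enters the choice of witnesses only here: interval ends are unbounded, which
`until_witness` needs to find the first interval beyond a lower bound. -/
theorem exists_le_hi (x : ℝ) : ∃ i, x ≤ σ.hi i := by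
  obtain ⟨i, hi⟩ := σ.covers (max x 0) (le_max_right _ _)
  exact ⟨i, (le_max_left _ _).trans (le_hi_of_mem hi)⟩

/-! ### From points to interval indices -/

variable (σ) in
/-- `A i` is the constant truth value of `P` on the `i`-th interval. -/
def Const (P : ℕ → ℝ → Prop) (A : ℕ → Prop) : Prop :=
  ∀ i, ∀ t ∈ σ.interval i, P i t ↔ A i

/-- The truth value of `φ` on the intervals of a `φ`-fine trace. -/
def truth (σ : SDTrace AP) (φ : MITL AP) (i : ℕ) : Prop :=
  ∃ t ∈ σ.interval i, σ.Sat φ i t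

theorem Fine.const {φ ψ : MITL AP} (h : σ.Fine φ) (hψ : ψ ∈ φ.sub) :
    σ.Const (σ.Sat ψ) (σ.truth ψ) := fun i t ht =>
  ⟨fun hs => ⟨t, ht, hs⟩, fun ⟨u, hu, hs⟩ => (h ψ hψ i t ht u hu).2 hs⟩

variable {P Q : ℕ → ℝ → Prop} {A B : ℕ → Prop} {r : TimeRel} {n : ℕ}

/-- An open interval has points after any of its points and before any of its points. So an open
first or last interval contributes a point strictly between, while a singleton at either end
contributes none. A witness in the starting interval itself forces that interval to be open. -/
theorem UntilAt.exists_index (hP : σ.Const P A) (hQ : σ.Const Q B) {i : ℕ} {t : ℝ}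
    (ht : t ∈ σ.interval i) (h : σ.UntilAt r n P Q i t) :
    ∃ j u, i ≤ j ∧ u ∈ σ.interval j ∧ t ≤ u ∧ (i = j → t < u) ∧ r.Holds (u - t) n ∧ B j ∧
      (j = i → σ.IsOpen i) ∧ (σ.IsOpen i → A i) ∧ (∀ m, i < m → m < j → A m) ∧
      (σ.IsOpen j → A j) := by
  obtain ⟨j, u, hu, he, hr, hq, hp⟩ := h
  have hij : i ≤ j := he.elim le_of_lt fun e => e.1.le
  have htu : i = j → t < u := fun e => he.elim (fun h => absurd e h.ne) fun e => e.2
  have htu' : t ≤ u := he.elim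
    (fun h => (le_hi_of_mem ht).trans ((hi_le_lo h).trans (lo_le_of_mem hu))) fun e => e.2.le
  refine ⟨j, u, hij, hu, htu', htu, hr, (hQ j u hu).1 hq, ?_, ?_, ?_, ?_⟩
  · rintro rfl
    exact isOpen_of_lt ht hu (htu rfl)
  · intro ho
    rcases hij.eq_or_lt with rfl | hlt
    · obtain ⟨w, hw1, hw2⟩ := exists_between (htu rfl)
      have hw : w ∈ σ.interval i := (mem_interval_of_open ho).2
        ⟨(lo_lt_of_mem ho ht).trans hw1, hw2.trans (lt_hi_of_mem ho hu)⟩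
      exact (hP i w hw).1 (hp i w hw (.inr ⟨rfl, hw1⟩) (.inr ⟨rfl, hw2⟩))
    · obtain ⟨w, hw, hw1⟩ := exists_mem_gt i (lt_hi_of_mem ho ht)
      exact (hP i w hw).1 (hp i w hw (.inr ⟨rfl, hw1⟩) (.inl hlt))
  · intro m him hmj
    obtain ⟨w, hw⟩ := σ.interval_nonempty m
    exact (hP m w hw).1 (hp m w hw (.inl him) (.inl hmj))
  · intro ho
    rcases hij.eq_or_lt with rfl | hlt
    · obtain ⟨w, hw1, hw2⟩ := exists_between (htu rfl)
      have hw : w ∈ σ.interval i := (mem_interval_of_open ho).2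
        ⟨(lo_lt_of_mem ho ht).trans hw1, hw2.trans (lt_hi_of_mem ho hu)⟩
      exact (hP i w hw).1 (hp i w hw (.inr ⟨rfl, hw1⟩) (.inr ⟨rfl, hw2⟩))
    · obtain ⟨w, hw, hw1⟩ := exists_mem_lt j (lo_lt_of_mem ho hu)
      exact (hP j w hw).1 (hp j w hw (.inl hlt) (.inr ⟨rfl, hw1⟩))

theorem UntilAt.of_index (hP : σ.Const P A) (hQ : σ.Const Q B) {i j : ℕ} {t u : ℝ}
    (ht : t ∈ σ.interval i) (hu : u ∈ σ.interval j) (he : Earlier i t j u)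
    (hr : r.Holds (u - t) n) (hB : B j) (hi : σ.IsOpen i → A i)
    (hm : ∀ m, i < m → m < j → A m) (hj : σ.IsOpen j → A j) : σ.UntilAt r n P Q i t := by
  refine ⟨j, u, hu, he, hr, (hQ j u hu).2 hB, fun k w hw h1 h2 => (hP k w hw).2 ?_⟩
  rcases h1 with h1 | ⟨rfl, h1⟩
  · rcases h2 with h2 | ⟨rfl, h2⟩
    · exact hm k h1 h2
    · exact hj (isOpen_of_lt hw hu h2)
  · exact hi (isOpen_of_lt ht hw h1)

/-- A releasing point in the first or last interval differs in time from the given point of that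
interval, so it can exist only if that interval is open. -/
theorem ReleaseAt.index (hP : σ.Const P A) (hQ : σ.Const Q B) {i j : ℕ} {t u : ℝ}
    (h : σ.ReleaseAt r n P Q i t) (ht : t ∈ σ.interval i) (hu : u ∈ σ.interval j)
    (he : Earlier i t j u) (hr : r.Holds (u - t) n) (hB : ¬ B j) :
    (∃ m, i < m ∧ m < j ∧ A m) ∨ (σ.IsOpen i ∧ A i) ∨ (σ.IsOpen j ∧ A j) := by
  obtain ⟨k, w, hw, h1, h2, hp⟩ := h j u hu he ⟨hr, fun hq => hB ((hQ j u hu).1 hq)⟩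
  have hA := (hP k w hw).1 hp
  rcases h1 with h1 | ⟨rfl, h1⟩
  · rcases h2 with h2 | ⟨rfl, h2⟩
    · exact .inl ⟨k, h1, h2, hA⟩
    · exact .inr (.inr ⟨isOpen_of_lt hw hu h2, hA⟩)
  · exact .inr (.inl ⟨isOpen_of_lt ht hw h1, hA⟩)

end SDTrace

/-! ### Clocks and flags determined by their resets -/

open Classical in
/-- A clock with the initial value `c₀` that is reset after step `i` if `R i`, and otherwise
advances by `d i`. -/
noncomputable def clockSeq (c₀ : ℝ) (d : ℕ → ℝ) (R : ℕ → Prop) : ℕ → ℝ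
  | 0 => c₀
  | i + 1 => if R i then 0 else clockSeq c₀ d R i + d i

/-- A flag that is initially false, is set to `b i` after step `i` if `R i`, and otherwise
remains unchanged. -/
def flagSeq (b R : ℕ → Prop) : ℕ → Prop
  | 0 => False
  | i + 1 => (R i ∧ b i) ∨ (¬ R i ∧ flagSeq b R i)

section Sequences

variable {c₀ : ℝ} {d : ℕ → ℝ} {b R : ℕ → Prop} {i : ℕ}

theorem clockSeq_reset (h : R i) : clockSeq c₀ d R (i + 1) = 0 := if_pos h

theorem clockSeq_advance (h : ¬ R i) : clockSeq c₀ d R (i + 1) = clockSeq c₀ d R i + d i :=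
  if_neg h

theorem clockSeq_nonneg (h₀ : 0 ≤ c₀) (hd : ∀ i, 0 ≤ d i) : ∀ i, 0 ≤ clockSeq c₀ d R i
  | 0 => h₀
  | i + 1 => by
    by_cases h : R i
    · exact (clockSeq_reset h).ge
    · exact (add_nonneg (clockSeq_nonneg h₀ hd i) (hd i)).trans_eq (clockSeq_advance h).symm

theorem flagSeq_reset (h : R i) : flagSeq b R (i + 1) ↔ b i := by
  simp [flagSeq, h]

theorem flagSeq_advance (h : ¬ R i) : flagSeq b R (i + 1) ↔ flagSeq b R i := by
  simp [flagSeq, h]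

end Sequences

namespace SDTrace

variable {AP : Type u} {σ : SDTrace AP}

variable (σ) in
/-- The duration of the `i`-th interval. -/
def dur (i : ℕ) : ℝ := σ.hi i - σ.lo i

theorem dur_nonneg (i : ℕ) : 0 ≤ σ.dur i := sub_nonneg.2 (σ.lo_le_hi i)

theorem dur_pos {i : ℕ} : 0 < σ.dur i ↔ σ.IsOpen i := sub_pos

theorem lo_add_dur (i : ℕ) : σ.lo i + σ.dur i = σ.lo (i + 1) := by
  rw [σ.lo_succ, dur]; ring

theorem not_open_zero : ¬ σ.IsOpen 0 := by
  simp [IsOpen, σ.lo_zero, σ.hi_zero]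

theorem hi_le_of_mem {i j : ℕ} {u : ℝ} (h : i < j) (hu : u ∈ σ.interval j) : σ.hi i ≤ u :=
  (hi_le_lo h).trans (lo_le_of_mem hu)

variable {P Q : ℕ → ℝ → Prop} {A B O : ℕ → Prop} {n : ℕ}

/-! ### The until operator without time bound -/

section Until

variable (hP : σ.Const P A) (hQ : σ.Const Q B) (hO : σ.Const (σ.UntilAt .ge 0 P Q) O)
include hP hQ hO

/-- Without a positive bound, the rest of a path to a witness is again a path to it, so the
obligation passes to each interval on the way. It is enough to treat one point of interval `i`; if
`j = i`, openness provides one before `u`. -/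
theorem until_succ {i j : ℕ} {u : ℝ} (hu : u ∈ σ.interval j) (hB : B j)
    (hij : i ≤ j) (ho : j = i → σ.IsOpen i) (hi : σ.IsOpen i → A i)
    (hm : ∀ m, i < m → m < j → A m) (hj : σ.IsOpen j → A j) : O i := by
  rcases hij.eq_or_lt with rfl | hlt
  · obtain ⟨t, ht, htu⟩ := exists_mem_lt i (lo_lt_of_mem (ho rfl) hu)
    refine (hO i t ht).1 (.of_index hP hQ ht hu (.inr ⟨rfl, htu⟩) ?_ hB hi hm hj)
    simpa [TimeRel.Holds] using htu.le
  · obtain ⟨t, ht⟩ := σ.interval_nonempty i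
    refine (hO i t ht).1 (.of_index hP hQ ht hu (.inl hlt) ?_ hB hi hm hj)
    simpa [TimeRel.Holds] using (le_hi_of_mem ht).trans (hi_le_of_mem hlt hu)

theorem until_open {i : ℕ} (h : O i) (ho : σ.IsOpen i) :
    A i ∧ (B i ∨ B (i + 1) ∨ (A (i + 1) ∧ O (i + 1))) := by
  obtain ⟨t, ht⟩ := σ.interval_nonempty i
  obtain ⟨j, u, hij, hu, -, -, -, hB, -, h1, h2, h3⟩ :=
    UntilAt.exists_index hP hQ ht ((hO i t ht).2 h)
  refine ⟨h1 ho, ?_⟩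
  rcases hij.eq_or_lt with rfl | hlt
  · exact .inl hB
  rcases (Nat.succ_le_of_lt hlt).eq_or_lt with rfl | hlt'
  · exact .inr (.inl hB)
  · have hA := h2 (i + 1) (lt_add_one i) hlt'
    exact .inr (.inr ⟨hA, until_succ hP hQ hO hu hB hlt'.le (fun e => absurd e hlt'.ne')
      (fun _ => hA) (fun m hm => h2 m (by omega)) h3⟩)

theorem until_not_open {i : ℕ} (h : O i) (ho : ¬ σ.IsOpen i) :
    (¬ σ.IsOpen (i + 1) ∧ B (i + 1)) ∨ (A (i + 1) ∧ O (i + 1)) := by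
  obtain ⟨t, ht⟩ := σ.interval_nonempty i
  obtain ⟨j, u, hij, hu, -, -, -, hB, h0, h1, h2, h3⟩ :=
    UntilAt.exists_index hP hQ ht ((hO i t ht).2 h)
  rcases hij.eq_or_lt with rfl | hlt
  · exact absurd (h0 rfl) ho
  rcases (Nat.succ_le_of_lt hlt).eq_or_lt with rfl | hlt'
  · by_cases ho' : σ.IsOpen (i + 1)
    · exact .inr ⟨h3 ho', until_succ hP hQ hO hu hB le_rfl (fun _ => ho')
        h3 (fun m hm hm' => absurd hm hm'.not_gt) h3⟩
    · exact .inl ⟨ho', hB⟩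
  · have hA := h2 (i + 1) (lt_add_one i) hlt'
    exact .inr ⟨hA, until_succ hP hQ hO hu hB hlt'.le (fun e => absurd e hlt'.ne')
      (fun _ => hA) (fun m hm => h2 m (by omega)) h3⟩

omit hP in
theorem until_fair (m : ℕ) : ∃ i, m ≤ i ∧ (¬ O i ∨ B i) := by
  by_cases h : O m
  · obtain ⟨t, ht⟩ := σ.interval_nonempty m
    obtain ⟨j, u, hu, he, -, hq, -⟩ := (hO m t ht).2 h
    exact ⟨j, he.elim le_of_lt fun e => e.1.le, .inr ((hQ j u hu).1 hq)⟩
  · exact ⟨m, le_rfl, .inl h⟩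

end Until

/-! ### Eventually, with upper time bound -/

section Ev

theorem const_true : σ.Const (fun _ _ => True) fun _ => True := fun _ _ _ => Iff.rfl

theorem const_false : σ.Const (fun _ _ => False) fun _ => False := fun _ _ _ => Iff.rfl

/-- The witness has the same time value as the starting point and hence a larger index. No time
passes on the way, so neither the starting interval nor the next one can be open. -/
theorem ev_zero (hQ : σ.Const Q B) (hO : σ.Const (σ.UntilAt .le 0 (fun _ _ => True) Q) O)
    {i : ℕ} (h : O i) :
    ¬ σ.IsOpen i ∧ ¬ σ.IsOpen (i + 1) ∧ (B (i + 1) ∨ O (i + 1)) := by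
  obtain ⟨t, ht⟩ := σ.interval_nonempty i
  obtain ⟨j, u, hij, hu, htu, hlt, hr, hB, h0, -⟩ :=
    UntilAt.exists_index const_true hQ ht ((hO i t ht).2 h)
  have hut : u = t := by
    simp only [TimeRel.Holds, Nat.cast_zero, sub_nonpos] at hr
    exact le_antisymm hr htu
  subst hut
  have hij' : i < j := lt_of_le_of_ne hij fun e => (hlt e).false
  have ho : ¬ σ.IsOpen i := fun ho => (lt_hi_of_mem ho ht).not_ge (hi_le_of_mem hij' hu)
  have ht' := (mem_interval_of_not_open ho).1 ht
  have ho' : ¬ σ.IsOpen (i + 1) := fun ho' => by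
    have h1 := lo_le_lo (σ := σ) hij'.le
    rcases (Nat.succ_le_of_lt hij').eq_or_lt with rfl | hlt'
    · have := lo_lt_of_mem ho' hu
      linarith [σ.lo_succ i, hi_eq_lo ho]
    · have := hi_le_of_mem hlt' hu
      have := σ.lo_succ i
      unfold IsOpen at ho'
      linarith [hi_eq_lo ho]
  refine ⟨ho, ho', ?_⟩
  rcases (Nat.succ_le_of_lt hij').eq_or_lt with rfl | hlt'
  · exact .inl hB
  · right
    have hm : u ∈ σ.interval (i + 1) := (mem_interval_of_not_open ho').2
      (by rw [σ.lo_succ, hi_eq_lo ho, ht'])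
    exact (hO _ u hm).1 (.of_index const_true hQ hm hu (.inl hlt') (by simp [TimeRel.Holds])
      hB (fun _ => trivial) (fun _ _ _ => trivial) fun _ => trivial)

/-- The index-level timing condition of `F_{< n}` and `F_{≤ n}`. -/
def EvTiming : TimeRel → ℕ → ℝ → Prop → Prop → Prop
  | .lt, n, x, lo, _ => x < n ∨ (lo ∧ x ≤ n)
  | _, n, x, lo, op => x < n ∨ ((¬ op ∨ lo) ∧ x ≤ n)

theorem EvTiming.le {r : TimeRel} {x : ℝ} {l p : Prop} (h : EvTiming r n x l p) : x ≤ n := by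
  cases r <;> exact h.elim le_of_lt And.right

theorem EvTiming.of_lt {r : TimeRel} {x : ℝ} {l p : Prop} (h : x < n) : EvTiming r n x l p := by
  cases r <;> exact .inl h

theorem EvTiming.congr {r : TimeRel} {x : ℝ} {l l' p : Prop} (h : l ↔ l') :
    EvTiming r n x l p ↔ EvTiming r n x l' p := by
  cases r <;> simp [EvTiming, h]

theorem EvTiming.mono {r : TimeRel} {x y : ℝ} {l p : Prop} (h : EvTiming r n x l p)
    (hxy : y ≤ x) : EvTiming r n y l p := by
  cases r <;> exact h.imp hxy.trans_lt (And.imp_right hxy.trans)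

variable {r : TimeRel} (hr : r = .lt ∨ r = .le) (hQ : σ.Const Q B)
    (hO : σ.Const (σ.UntilAt r n (fun _ _ => True) Q) O)
include hr hQ hO

theorem ev_succ {i : ℕ} (h : O i) :
    (σ.IsOpen i ∧ B i) ∨ B (i + 1) ∨ O (i + 1) := by
  obtain ⟨t, ht⟩ := σ.interval_nonempty i
  obtain ⟨j, u, hij, hu, htu, hlt, hr', hB, h0, -⟩ :=
    UntilAt.exists_index const_true hQ ht ((hO i t ht).2 h)
  rcases hij.eq_or_lt with rfl | hlt
  · exact .inl ⟨h0 rfl, hB⟩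
  rcases (Nat.succ_le_of_lt hlt).eq_or_lt with rfl | hlt'
  · exact .inr (.inl hB)
  · obtain ⟨w, hw⟩ := σ.interval_nonempty (i + 1)
    have htw : t ≤ w := (le_hi_of_mem ht).trans (hi_le_of_mem (lt_add_one i) hw)
    refine .inr (.inr ((hO _ w hw).1 (.of_index const_true hQ hw hu (.inl hlt') ?_
      hB (fun _ => trivial) (fun _ _ _ => trivial) fun _ => trivial)))
    rcases hr with rfl | rfl <;> simp only [TimeRel.Holds] at hr' ⊢ <;> linarith

/-- Where the formula holds, there is a single interval that witnesses it for all points. -/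
theorem ev_witness {i : ℕ} (h : O i) :
    ∃ j, i ≤ j ∧ (j = i → σ.IsOpen i) ∧ B j ∧
      EvTiming r n (σ.lo j - σ.lo i) (σ.IsOpen i) (σ.IsOpen j) := by
  classical
  have key : ∀ t ∈ σ.interval i, ∃ j, (i ≤ j ∧ (j = i → σ.IsOpen i) ∧ B j) ∧
      ∃ u ∈ σ.interval j, r.Holds (u - t) n := by
    intro t ht
    obtain ⟨j, u, hij, hu, -, -, hr', hB, h0, -⟩ :=
      UntilAt.exists_index const_true hQ ht ((hO i t ht).2 h)
    exact ⟨j, ⟨hij, h0, hB⟩, u, hu, hr'⟩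
  have ex : ∃ j, i ≤ j ∧ (j = i → σ.IsOpen i) ∧ B j := by
    obtain ⟨t, ht⟩ := σ.interval_nonempty i
    obtain ⟨j, hj, -⟩ := key t ht
    exact ⟨j, hj⟩
  obtain ⟨h1, h2, h3⟩ := Nat.find_spec ex
  refine ⟨Nat.find ex, h1, h2, h3, ?_⟩
  have key' : ∀ t ∈ σ.interval i, ∃ u, σ.lo (Nat.find ex) ≤ u ∧ r.Holds (u - t) n ∧
      (σ.IsOpen (Nat.find ex) → σ.lo (Nat.find ex) < u) := by
    intro t ht
    obtain ⟨j, hj, u, hu, hr'⟩ := key t ht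
    have hle := Nat.find_min' ex hj
    refine ⟨u, (lo_le_lo hle).trans (lo_le_of_mem hu), hr', fun ho => ?_⟩
    rcases hle.eq_or_lt with e | hlt
    · rw [← e] at hu
      exact lo_lt_of_mem ho hu
    · exact lt_of_lt_of_le ho (hi_le_of_mem hlt hu)
  by_cases ho : σ.IsOpen i
  · have hle : σ.lo (Nat.find ex) - σ.lo i ≤ n := by
      by_contra! hlt
      -- A point this close to the left end cannot reach the candidate within `n`, although it must
      -- have a witness.
      obtain ⟨t, ht, htx⟩ := exists_mem_lt i (x := σ.lo (Nat.find ex) - n) (by linarith)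
      obtain ⟨u, hu, hr', -⟩ := key' t ht
      rcases hr with rfl | rfl <;> simp only [TimeRel.Holds] at hr' <;> linarith
    rcases hr with rfl | rfl
    · exact .inr ⟨ho, hle⟩
    · exact .inr ⟨.inr ho, hle⟩
  · obtain ⟨u, hu, hr', hs⟩ := key' _ ((mem_interval_of_not_open ho).2 rfl)
    rcases hr with rfl | rfl <;> simp only [TimeRel.Holds] at hr'
    · exact .inl (by linarith)
    · by_cases ho' : σ.IsOpen (Nat.find ex)
      · exact .inl (by linarith [hs ho'])
      · exact .inr ⟨.inl ho', by linarith⟩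

/-- `R` stands for the operand variable, which the reset condition also uses negatively and which
may exceed `B`. Resetting too often is harmless: after each reset `ev_witness` gives a new
discharging interval. Without a reset, `R` was not seen, so `B` was not either, and the old
discharging interval is still ahead. -/
theorem ev_exists {R : ℕ → Prop} (hR : ∀ i, B i → R i) :
    ∃ (c : ℕ → ℝ) (lo : ℕ → Prop), (∀ i, 0 ≤ c i) ∧ c 0 = 0 ∧ ¬ lo 0 ∧ ∀ i,
      ((¬ O i ∨ (σ.IsOpen i ∧ R i) ∨ R (i + 1)) ∧ O (i + 1) →
        c (i + 1) = 0 ∧ (lo (i + 1) ↔ σ.IsOpen (i + 1))) ∧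
      (¬ ((¬ O i ∨ (σ.IsOpen i ∧ R i) ∨ R (i + 1)) ∧ O (i + 1)) →
        c (i + 1) = c i + σ.dur i ∧ (lo (i + 1) ↔ lo i)) ∧
      (O i ∧ ¬ (R i ∧ σ.IsOpen i) → EvTiming r n (c i + σ.dur i) (lo i) (σ.IsOpen (i + 1))) := by
  set D : ℕ → Prop := fun i => (¬ O i ∨ (σ.IsOpen i ∧ R i) ∨ R (i + 1)) ∧ O (i + 1) with hD
  set c := clockSeq 0 σ.dur D with hc
  set lo := flagSeq (fun i => σ.IsOpen (i + 1)) D with hlo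
  -- The expression `c i + (σ.lo j - σ.lo i)` is the clock value on reaching interval `j` without
  -- further resets. Advancing the clock by the duration of `i` leaves it unchanged.
  have inv : ∀ i, O i → ∃ j, i ≤ j ∧ (j = i → σ.IsOpen i) ∧ B j ∧
      EvTiming r n (c i + (σ.lo j - σ.lo i)) (lo i) (σ.IsOpen j) := by
    intro i
    induction i with
    | zero =>
      intro h
      obtain ⟨j, h1, h2, h3, h4⟩ := ev_witness hr hQ hO h
      refine ⟨j, h1, h2, h3, ?_⟩
      -- The initial flag, false, is the right one because the first interval is a singleton.
      rw [EvTiming.congr (l' := σ.IsOpen 0) (by simp [hlo, flagSeq, not_open_zero])]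
      simpa [hc, clockSeq] using h4
    | succ i ih =>
      intro h
      by_cases hd : D i
      · obtain ⟨j, h1, h2, h3, h4⟩ := ev_witness hr hQ hO h
        refine ⟨j, h1, h2, h3, ?_⟩
        rw [EvTiming.congr (flagSeq_reset hd), hc, clockSeq_reset hd, zero_add]
        exact h4
      · have hd' : O i ∧ ¬ (σ.IsOpen i ∧ R i) ∧ ¬ R (i + 1) := by
          simp only [hD, h, and_true] at hd
          tauto
        obtain ⟨j, h1, h2, h3, h4⟩ := ih hd'.1
        have hne : j ≠ i := by
          rintro rfl
          exact hd'.2.1 ⟨h2 rfl, hR _ h3⟩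
        have hne' : j ≠ i + 1 := by
          rintro rfl
          exact hd'.2.2 (hR _ h3)
        refine ⟨j, by omega, fun e => absurd e hne', h3, ?_⟩
        rw [EvTiming.congr (flagSeq_advance hd), hc, clockSeq_advance hd]
        convert h4 using 1
        linarith [lo_add_dur (σ := σ) i]
  refine ⟨c, lo, clockSeq_nonneg le_rfl dur_nonneg, rfl, id, fun i =>
    ⟨fun h => ⟨clockSeq_reset h, flagSeq_reset h⟩,
      fun h => ⟨clockSeq_advance h, flagSeq_advance h⟩, ?_⟩⟩
  rintro ⟨h, hnr⟩
  obtain ⟨j, h1, h2, h3, h4⟩ := inv i h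
  have hij : i < j := lt_of_le_of_ne h1 fun e => hnr (by subst e; exact ⟨hR _ h3, h2 rfl⟩)
  have hd := lo_add_dur (σ := σ) i
  rcases (Nat.succ_le_of_lt hij).eq_or_lt with rfl | hlt
  · convert h4 using 1
    linarith
  -- The constraint tests the timing at the start of interval `i + 1`, but the witness lies further
  -- on. If `i + 1` is open, time passes before `j` and the inequality is strict; otherwise its
  -- being a singleton permits equality for `≤`.
  · by_cases ho : σ.IsOpen (i + 1)
    · have h5 : σ.lo (i + 1) < σ.lo j := lt_of_lt_of_le ho (hi_le_lo hlt)
      exact .of_lt (by linarith [h4.le])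
    · have h5 : σ.lo (i + 1) ≤ σ.lo j := lo_le_lo hlt.le
      have h6 := h4.mono (y := c i + σ.dur i) (by linarith)
      rcases hr with rfl | rfl
      · exact h6
      · rcases h6 with h6 | h6
        · exact .inl h6
        · exact .inr ⟨.inl ho, h6.2⟩

end Ev

end SDTrace

namespace SDTrace

variable {AP : Type u} {σ : SDTrace AP}
variable {P Q : ℕ → ℝ → Prop} {A B O : ℕ → Prop} {n : ℕ}

/-! ### The until operators with lower time bound -/

section UntilLower

/-- The index-level timing condition of `U_{≥ n}` and `U_{> n}`. -/
def UntilTiming : TimeRel → ℕ → ℝ → Prop → Prop → Prop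
  | .ge, n, x, ro, op => x > n ∨ ((ro ∨ ¬ op) ∧ x ≥ n)
  | _, n, x, ro, _ => x > n ∨ (ro ∧ x ≥ n)

theorem UntilTiming.ge {r : TimeRel} {x : ℝ} {l p : Prop} (h : UntilTiming r n x l p) :
    x ≥ n := by
  cases r <;> exact h.elim le_of_lt And.right

theorem UntilTiming.of_gt {r : TimeRel} {x : ℝ} {l p : Prop} (h : x > n) :
    UntilTiming r n x l p := by
  cases r <;> exact .inl h

theorem UntilTiming.congr {r : TimeRel} {x : ℝ} {l l' p : Prop} (h : l ↔ l') :
    UntilTiming r n x l p ↔ UntilTiming r n x l' p := by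
  cases r <;> simp [UntilTiming, h]

variable {r : TimeRel} (hr : r = .ge ∨ r = .gt) (hP : σ.Const P A) (hQ : σ.Const Q B)
    (hO : σ.Const (σ.UntilAt r n P Q) O)
include hr hP hQ hO

/-- Where the formula holds, there is a single interval that witnesses it for all points. -/
theorem until_witness {i : ℕ} (h : O i) :
    (σ.IsOpen i → A i) ∧ ∃ j, i ≤ j ∧ (j = i → σ.IsOpen i ∧ n = 0) ∧ B j ∧
      (i < j → UntilTiming r n (σ.hi j - σ.hi i) (σ.IsOpen i) (σ.IsOpen j)) ∧
      (∀ m, i < m → m < j → A m) ∧ (σ.IsOpen j → A j) := by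
  classical
  have key : ∀ t ∈ σ.interval i, ∃ j u, (i ≤ j ∧ (j = i → σ.IsOpen i) ∧ B j ∧
      (∀ m, i < m → m < j → A m) ∧ (σ.IsOpen j → A j)) ∧ (σ.IsOpen i → A i) ∧
      u ∈ σ.interval j ∧ r.Holds (u - t) n := by
    intro t ht
    obtain ⟨j, u, hij, hu, -, -, hr', hB, h0, h1, h2, h3⟩ :=
      UntilAt.exists_index hP hQ ht ((hO i t ht).2 h)
    exact ⟨j, u, ⟨hij, h0, hB, h2, h3⟩, h1, hu, hr'⟩
  by_cases ho : σ.IsOpen i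
  · obtain ⟨t₀, ht₀⟩ := σ.interval_nonempty i
    refine ⟨(key t₀ ht₀).choose_spec.choose_spec.2.1, ?_⟩
    -- Consider the first interval ending at or after `σ.hi i + n`. All earlier ends are strictly
    -- smaller, so some `t` near the right end of `i` has all of them before `t + n`. The witness of
    -- this one `t` cannot lie in an earlier interval, and therefore serves the whole interval `i`.
    have far : ∃ j u, (i ≤ j ∧ (j = i → σ.IsOpen i) ∧ B j ∧ (∀ m, i < m → m < j → A m) ∧
        (σ.IsOpen j → A j)) ∧ u ∈ σ.interval j ∧ σ.hi i + n ≤ σ.hi j := by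
      have ex := σ.exists_le_hi (σ.hi i + n)
      obtain ⟨t, ht, hlt⟩ : ∃ t ∈ σ.interval i, ∀ j < Nat.find ex, σ.hi j - n < t := by
        rcases Nat.eq_zero_or_pos (Nat.find ex) with h0 | h0
        · exact ⟨t₀, ht₀, fun j hj => absurd hj (by omega)⟩
        · have := Nat.find_min ex (Nat.sub_lt h0 one_pos)
          obtain ⟨t, ht, h⟩ := exists_mem_gt i (x := σ.hi (Nat.find ex - 1) - n) (by linarith)
          refine ⟨t, ht, fun j hj => lt_of_le_of_lt ?_ h⟩
          linarith [hi_le_hi (σ := σ) (show j ≤ Nat.find ex - 1 by omega)]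
      obtain ⟨j, u, h1, -, hu, hr'⟩ := key t ht
      refine ⟨j, u, h1, hu, (Nat.find_spec ex).trans (hi_le_hi ?_)⟩
      by_contra! hj
      have h2 := hlt j hj
      have h3 := le_hi_of_mem hu
      rcases hr with rfl | rfl <;> simp only [TimeRel.Holds] at hr' <;> linarith
    obtain ⟨j, u, ⟨h1, h2, h3, h4, h5⟩, hu, hj⟩ := far
    refine ⟨j, h1, fun e => ⟨ho, ?_⟩, h3, fun _ => ?_, h4, h5⟩
    · subst e
      have : (n : ℝ) ≤ 0 := by linarith
      exact Nat.le_zero.1 (by exact_mod_cast this)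
    · have : σ.hi j - σ.hi i ≥ n := by linarith
      rcases hr with rfl | rfl
      · exact .inr ⟨.inl ho, this⟩
      · exact .inr ⟨ho, this⟩
  · obtain ⟨j, u, ⟨h1, h2, h3, h4, h5⟩, -, hu, hr'⟩ :=
      key _ ((mem_interval_of_not_open ho).2 rfl)
    refine ⟨fun h => absurd h ho, j, h1, fun e => absurd (h2 e) ho, h3, fun _ => ?_, h4, h5⟩
    have h6 := le_hi_of_mem hu
    have h7 := hi_eq_lo ho
    rcases hr with rfl | rfl <;> simp only [TimeRel.Holds] at hr'
    · by_cases ho' : σ.IsOpen j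
      · exact .inl (by linarith [lt_hi_of_mem ho' hu])
      · exact .inr ⟨.inr ho', by linarith⟩
    · exact .inl (by linarith)

/-- The clock restarts at every interval where the formula holds, and the newest obligation replaces
any pending one. Nothing is lost for completeness, because `until_witness` supplies a path for the
new obligation; a pending path is followed only through intervals where the formula fails. -/
theorem untilLower_exists :
    ∃ (c : ℕ → ℝ) (ro ob : ℕ → Prop), (∀ i, 0 ≤ c i) ∧
      (∀ m, ∃ i, m ≤ i ∧ (¬ ob i ∨ B i)) ∧ ∀ i, (O i → ob i) ∧
      (0 < n → O i → ob (i + 1) ∧ A (i + 1)) ∧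
      (ob i → σ.IsOpen i → A i ∧
        ((B i ∧ UntilTiming r n (c i + σ.dur i) (ro i) (σ.IsOpen i)) ∨
        (B (i + 1) ∧ UntilTiming r n (c (i + 1) + σ.dur (i + 1)) (ro (i + 1))
          (σ.IsOpen (i + 1))) ∨ (A (i + 1) ∧ ob (i + 1)))) ∧
      (ob i → ¬ σ.IsOpen i →
        (¬ σ.IsOpen (i + 1) ∧ B (i + 1) ∧ UntilTiming r n (c (i + 1) + σ.dur (i + 1))
          (ro (i + 1)) (σ.IsOpen (i + 1))) ∨ (A (i + 1) ∧ ob (i + 1))) ∧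
      (O i → c (i + 1) = 0 ∧ (ro (i + 1) ↔ σ.IsOpen i)) ∧
      (¬ O i → c (i + 1) = c i + σ.dur i ∧ (ro (i + 1) ↔ ro i)) := by
  set c := clockSeq 0 σ.dur O with hc
  set ro := flagSeq σ.IsOpen O with hro
  have hc0 : ∀ i, 0 ≤ c i := clockSeq_nonneg le_rfl dur_nonneg
  -- the obligation of an earlier point is pending
  set W : ℕ → Prop := fun i => ∃ j, i ≤ j ∧ (j = i → σ.IsOpen i) ∧ B j ∧
    UntilTiming r n (c i + (σ.hi j - σ.lo i)) (ro i) (σ.IsOpen j) ∧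
    (∀ m, i ≤ m → m < j → A m) ∧ (σ.IsOpen j → A j) with hW
  have next : ∀ i, (∃ j, i < j ∧ B j ∧
      UntilTiming r n (c (i + 1) + (σ.hi j - σ.lo (i + 1))) (ro (i + 1)) (σ.IsOpen j) ∧
      (∀ m, i < m → m < j → A m) ∧ (σ.IsOpen j → A j)) →
      (¬ σ.IsOpen (i + 1) ∧ B (i + 1) ∧ UntilTiming r n (c (i + 1) + σ.dur (i + 1))
          (ro (i + 1)) (σ.IsOpen (i + 1))) ∨ (A (i + 1) ∧ W (i + 1)) := by
    rintro i ⟨j, h1, h2, h3, h4, h5⟩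
    rcases (Nat.succ_le_of_lt h1).eq_or_lt with rfl | hlt
    · by_cases ho : σ.IsOpen (i + 1)
      · exact .inr ⟨h5 ho, _, le_rfl, fun _ => ho, h2, h3,
          fun m hm hm' => absurd hm' (by omega), h5⟩
      · exact .inl ⟨ho, h2, h3⟩
    · exact .inr ⟨h4 _ (lt_add_one i) hlt, j, hlt.le, fun e => absurd e hlt.ne', h2, h3,
        fun m hm => h4 m (by omega), h5⟩
  have of_out : ∀ i, O i → (σ.IsOpen i → A i) ∧ ((σ.IsOpen i ∧ n = 0 ∧ B i) ∨ ∃ j, i < j ∧ B j ∧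
      UntilTiming r n (c (i + 1) + (σ.hi j - σ.lo (i + 1))) (ro (i + 1)) (σ.IsOpen j) ∧
      (∀ m, i < m → m < j → A m) ∧ (σ.IsOpen j → A j)) := by
    intro i h
    obtain ⟨h0, j, h1, h2, h3, h4, h5, h6⟩ := until_witness hr hP hQ hO h
    refine ⟨h0, ?_⟩
    rcases h1.eq_or_lt with rfl | hlt
    · exact .inl ⟨(h2 rfl).1, (h2 rfl).2, h3⟩
    · refine .inr ⟨j, hlt, h3, ?_, h5, h6⟩
      rw [UntilTiming.congr (flagSeq_reset h), hc, clockSeq_reset h, zero_add, σ.lo_succ]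
      exact h4 hlt
  have of_pending : ∀ i, ¬ O i → W i → (σ.IsOpen i → A i) ∧
      ((σ.IsOpen i ∧ B i ∧ UntilTiming r n (c i + σ.dur i) (ro i) (σ.IsOpen i)) ∨
      ∃ j, i < j ∧ B j ∧
      UntilTiming r n (c (i + 1) + (σ.hi j - σ.lo (i + 1))) (ro (i + 1)) (σ.IsOpen j) ∧
      (∀ m, i < m → m < j → A m) ∧ (σ.IsOpen j → A j)) := by
    rintro i h ⟨j, h1, h2, h3, h4, h5, h6⟩
    rcases h1.eq_or_lt with rfl | hlt
    · exact ⟨h6, .inl ⟨h2 rfl, h3, h4⟩⟩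
    · refine ⟨fun _ => h5 i le_rfl hlt, .inr ⟨j, hlt, h3, ?_, fun m hm => h5 m hm.le, h6⟩⟩
      rw [UntilTiming.congr (flagSeq_advance h), hc, clockSeq_advance h]
      convert h4 using 1
      linarith [lo_add_dur (σ := σ) i]
  have step : ∀ i, O i ∨ W i → (σ.IsOpen i → A i) ∧
      ((σ.IsOpen i ∧ B i ∧ UntilTiming r n (c i + σ.dur i) (ro i) (σ.IsOpen i)) ∨
      ∃ j, i < j ∧ B j ∧
      UntilTiming r n (c (i + 1) + (σ.hi j - σ.lo (i + 1))) (ro (i + 1)) (σ.IsOpen j) ∧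
      (∀ m, i < m → m < j → A m) ∧ (σ.IsOpen j → A j)) := by
    intro i h
    by_cases hi : O i
    -- A witness inside the starting interval occurs only for `n = 0`. Then the timing condition
    -- holds for the current clock, whatever its value, since an open interval has positive
    -- duration.
    · refine (of_out i hi).imp_right fun h => h.imp_left fun ⟨h1, h2, h3⟩ => ⟨h1, h3, .of_gt ?_⟩
      rw [h2, Nat.cast_zero]
      exact add_pos_of_nonneg_of_pos (hc0 i) (dur_pos.2 h1)
    · exact of_pending i hi (h.resolve_left hi)
  refine ⟨c, ro, fun i => O i ∨ W i, hc0, ?_, fun i => ⟨.inl, ?_, ?_, ?_, ?_, ?_⟩⟩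
  · intro m
    by_cases h : O m ∨ W m
    · rcases (step m h).2 with ⟨-, h1, -⟩ | ⟨j, h1, h2, -⟩
      · exact ⟨m, le_rfl, .inr h1⟩
      · exact ⟨j, h1.le, .inr h2⟩
    · exact ⟨m, le_rfl, .inl h⟩
  · intro hn' h
    obtain ⟨-, ⟨-, h0, -⟩ | hj⟩ := of_out i h
    · exact absurd h0 hn'.ne'
    -- The obligation cannot end at a singleton `i + 1`: the clock was just reset and no time passes
    -- there, so the timing condition would give `n ≤ 0`.
    · rcases next i hj with ⟨h1, -, h2⟩ | ⟨h1, h2⟩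
      · have h3 := h2.ge
        rw [hc, clockSeq_reset h, zero_add, dur, hi_eq_lo h1, sub_self] at h3
        exact absurd hn' (by exact_mod_cast h3.not_gt)
      · exact ⟨.inr h2, h1⟩
  · intro h ho
    obtain ⟨h1, ⟨-, h2⟩ | hj⟩ := step i h
    · exact ⟨h1 ho, .inl h2⟩
    · refine ⟨h1 ho, .inr ?_⟩
      exact (next i hj).imp And.right fun h => ⟨h.1, .inr h.2⟩
  · intro h ho
    obtain ⟨h1, ⟨h2, -⟩ | hj⟩ := step i h
    · exact absurd h2 ho
    · exact (next i hj).imp_right fun h => ⟨h.1, .inr h.2⟩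
  · exact fun h => ⟨clockSeq_reset h, flagSeq_reset h⟩
  · exact fun h => ⟨clockSeq_advance h, flagSeq_advance h⟩

end UntilLower

/-! ### The release operator without time bound -/

section Release

/-- The obligation at `i` is read semantically: every failure of `B` from `i` on is preceded by `A`
at an index from `i` on, or occurs in an open interval satisfying `A`. If `A i` fails, the releasing
index is larger than `i`, so the property passes to `i + 1`. -/
theorem release_exists (hP : σ.Const P A) (hQ : σ.Const Q B)
    (hO : σ.Const (σ.ReleaseAt .ge 0 P Q) O) :
    ∃ ob : ℕ → Prop, ∀ i, (O i → σ.IsOpen i → ob i) ∧ (O i → ¬ σ.IsOpen i → ob (i + 1)) ∧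
      (ob i → A i ∨ ob (i + 1)) ∧ (ob i → (σ.IsOpen i ∧ A i) ∨ B i) := by
  refine ⟨fun i => ∀ j, i ≤ j → ¬ B j → (∃ m, i ≤ m ∧ m < j ∧ A m) ∨ (σ.IsOpen j ∧ A j),
    fun i => ⟨?_, ?_, ?_, ?_⟩⟩
  · intro h ho j hij hB
    have : ∃ t ∈ σ.interval i, ∃ u ∈ σ.interval j, Earlier i t j u ∧ 0 ≤ u - t := by
      obtain ⟨u, hu⟩ := σ.interval_nonempty j
      rcases hij.eq_or_lt with rfl | hlt
      · obtain ⟨t, ht, htu⟩ := exists_mem_lt i (lo_lt_of_mem ho hu)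
        exact ⟨t, ht, u, hu, .inr ⟨rfl, htu⟩, sub_nonneg.2 htu.le⟩
      · obtain ⟨t, ht⟩ := σ.interval_nonempty i
        exact ⟨t, ht, u, hu, .inl hlt, sub_nonneg.2 ((le_hi_of_mem ht).trans (hi_le_of_mem hlt hu))⟩
    obtain ⟨t, ht, u, hu, he, hut⟩ := this
    rcases ReleaseAt.index hP hQ ((hO i t ht).2 h) ht hu he (by simpa [TimeRel.Holds] using hut) hB
      with ⟨m, h1, h2, h3⟩ | h1 | h1
    · exact .inl ⟨m, h1.le, h2, h3⟩
    · rcases hij.eq_or_lt with rfl | hlt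
      · exact .inr h1
      · exact .inl ⟨i, le_rfl, hlt, h1.2⟩
    · exact .inr h1
  · intro h ho j hij hB
    obtain ⟨t, ht⟩ := σ.interval_nonempty i
    obtain ⟨u, hu⟩ := σ.interval_nonempty j
    have hut : 0 ≤ u - t := sub_nonneg.2 ((le_hi_of_mem ht).trans (hi_le_of_mem hij hu))
    rcases ReleaseAt.index hP hQ ((hO i t ht).2 h) ht hu (.inl hij)
      (by simpa [TimeRel.Holds] using hut) hB with ⟨m, h1, h2, h3⟩ | h1 | h1
    · exact .inl ⟨m, h1, h2, h3⟩
    · exact absurd h1.1 ho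
    · exact .inr h1
  · intro h
    refine or_iff_not_imp_left.2 fun hA j hij hB => ?_
    refine (h j (by omega) hB).imp_left fun ⟨m, h1, h2, h3⟩ => ⟨m, ?_, h2, h3⟩
    exact Nat.succ_le_of_lt (lt_of_le_of_ne h1 fun e => hA (e ▸ h3))
  · intro h
    refine or_iff_not_imp_right.2 fun hB => ?_
    exact (h i le_rfl hB).resolve_left fun ⟨m, h1, h2, _⟩ => by omega

end Release

/-! ### Always, with upper time bound -/

section Alw

/-- Two consecutive singletons have the same time value, and every point after the second is after
the first, so the requirement is inherited. -/
theorem alw_zero (hQ : σ.Const Q B) (hO : σ.Const (σ.ReleaseAt .le 0 (fun _ _ => False) Q) O)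
    {i : ℕ} (h : O i) : σ.IsOpen i ∨ σ.IsOpen (i + 1) ∨ (B (i + 1) ∧ O (i + 1)) := by
  by_cases ho : σ.IsOpen i
  · exact .inl ho
  by_cases ho' : σ.IsOpen (i + 1)
  · exact .inr (.inl ho')
  have ht : σ.lo i ∈ σ.interval i := (mem_interval_of_not_open ho).2 rfl
  have hu : σ.lo i ∈ σ.interval (i + 1) :=
    (mem_interval_of_not_open ho').2 (by rw [σ.lo_succ, hi_eq_lo ho])
  have h' := (hO i _ ht).2 h
  refine .inr (.inr ⟨?_, (hO _ _ hu).1 fun j u hj he hr => ?_⟩)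
  · by_contra hB
    obtain ⟨_, _, _, _, _, h⟩ := h' _ _ hu (.inl (lt_add_one i))
      ⟨by simp [TimeRel.Holds], fun hq => hB ((hQ _ _ hu).1 hq)⟩
    exact h
  · obtain ⟨_, _, _, _, _, h⟩ := h' j u hj
      (.inl ((lt_add_one i).trans_le (he.elim le_of_lt fun e => e.1.le))) hr
    exact h.elim

/-- The index-level timing condition of `G_{< n}` and `G_{≤ n}`. -/
def AlwTiming : TimeRel → ℕ → ℝ → Prop → Prop → Prop
  | .lt, n, x, _, _ => x < n
  | _, n, x, ro, op => x < n ∨ (x ≤ n ∧ ¬ op ∧ ¬ ro)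

theorem AlwTiming.congr {r : TimeRel} {x : ℝ} {l l' p : Prop} (h : l ↔ l') :
    AlwTiming r n x l p ↔ AlwTiming r n x l' p := by
  cases r <;> simp [AlwTiming, h]

theorem AlwTiming.le {r : TimeRel} {x : ℝ} {l p : Prop} (h : AlwTiming r n x l p) :
    x ≤ n := by
  cases r
  case lt => exact le_of_lt h
  all_goals exact h.elim le_of_lt And.left

/-- The clock measures time from the right end of the last interval where the formula held. Points
near that end extend the demand furthest, so this last interval alone justifies everything the
timing condition asks for. -/
theorem alw_exists {r : TimeRel} (hr : r = .lt ∨ r = .le) (hn : 0 < n) (hQ : σ.Const Q B)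
    (hO : σ.Const (σ.ReleaseAt r n (fun _ _ => False) Q) O) :
    ∃ (c : ℕ → ℝ) (ro : ℕ → Prop), (∀ i, 0 ≤ c i) ∧ ∀ i,
      ((O i ∧ σ.IsOpen i) ∨ AlwTiming r n (c i) (ro i) (σ.IsOpen i) → B i) ∧
      (O i → c (i + 1) = 0 ∧ (ro (i + 1) ↔ σ.IsOpen i)) ∧
      (¬ O i → c (i + 1) = c i + σ.dur i ∧ (ro (i + 1) ↔ ro i)) := by
  -- The start value exceeds `n`, so the timing condition stays false until the formula first holds.
  set c := clockSeq (n + 1) σ.dur O with hc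
  set ro := flagSeq σ.IsOpen O with hro
  have holds : ∀ {x : ℝ}, x < n → r.Holds x n := by
    intro x hx
    rcases hr with rfl | rfl
    · exact hx
    · exact hx.le
  have hB : ∀ {i j : ℕ} {t u : ℝ}, O i → t ∈ σ.interval i → u ∈ σ.interval j →
      Earlier i t j u → r.Holds (u - t) n → B j := by
    intro i j t u h ht hu he hh
    by_contra hB
    simpa using ReleaseAt.index const_false hQ ((hO i t ht).2 h) ht hu he hh hB
  have inv : ∀ i j, i ≤ j →
      AlwTiming r n (c i + (σ.lo j - σ.lo i)) (ro i) (σ.IsOpen j) → B j := by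
    intro i
    induction i with
    | zero =>
      intro j hj h
      have h1 := h.le
      have h2 : c 0 = n + 1 := rfl
      linarith [lo_le_lo (σ := σ) hj]
    | succ i ih =>
      intro j hj h
      by_cases hi : O i
      · rw [AlwTiming.congr (flagSeq_reset hi), hc, clockSeq_reset hi, zero_add, σ.lo_succ] at h
        -- A strict bound between the inner ends leaves room for a point near the right end of `i`
        -- and one near the left end of `j`. Equality remains usable only if both intervals are
        -- singletons.
        have near : σ.lo j - σ.hi i < n → B j := by
          intro h
          obtain ⟨t, ht, htj⟩ := exists_mem_gt i (x := max (σ.lo j - n) (σ.hi i - n))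
            (max_lt (by linarith) (by linarith [(Nat.cast_pos (α := ℝ)).2 hn]))
          obtain ⟨u, hu, huj⟩ := exists_mem_lt j (x := t + n)
            (by linarith [le_max_left (σ.lo j - n) (σ.hi i - n)])
          exact hB hi ht hu (.inl hj) (holds (by linarith))
        rcases hr with rfl | rfl
        · exact near h
        · rcases h with h | ⟨h, h1, h2⟩
          · exact near h
          · refine hB hi ((mem_interval_of_not_open h2).2 rfl)
              ((mem_interval_of_not_open h1).2 rfl) (.inl hj) ?_
            rwa [hi_eq_lo h2] at h
      · rw [AlwTiming.congr (flagSeq_advance hi), hc, clockSeq_advance hi] at h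
        refine ih j (by omega) ?_
        convert h using 1
        linarith [lo_add_dur (σ := σ) i]
  refine ⟨c, ro, clockSeq_nonneg (by positivity) dur_nonneg, fun i => ⟨?_,
    fun h => ⟨clockSeq_reset h, flagSeq_reset h⟩,
    fun h => ⟨clockSeq_advance h, flagSeq_advance h⟩⟩⟩
  rintro (⟨h, ho⟩ | h)
  · obtain ⟨t, ht⟩ := σ.interval_nonempty i
    obtain ⟨u, htu, hu⟩ := exists_between
      (lt_min (lt_hi_of_mem ho ht) (lt_add_of_pos_right t ((Nat.cast_pos (α := ℝ)).2 hn)))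
    refine hB h ht ((mem_interval_of_open ho).2 ⟨(lo_lt_of_mem ho ht).trans htu,
      hu.trans_le (min_le_left _ _)⟩) (.inr ⟨rfl, htu⟩) (holds ?_)
    linarith [hu.trans_le (min_le_right _ _)]
  · exact inv i i le_rfl (by simpa using h)

end Alw

/-! ### The release operators with lower time bound -/

section ReleaseLower

/-- The index-level timing condition of `R_{≥ n}` and `R_{> n}`. -/
def ReleaseTiming : TimeRel → ℕ → ℝ → Prop → Prop → Prop
  | .ge, n, x, lo, op => x > n ∨ (¬ lo ∧ ¬ op ∧ x ≥ n)
  | _, n, x, _, _ => x > n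

theorem ReleaseTiming.congr {r : TimeRel} {x : ℝ} {l l' p : Prop} (h : l ↔ l') :
    ReleaseTiming r n x l p ↔ ReleaseTiming r n x l' p := by
  cases r <;> simp [ReleaseTiming, h]

/-- The obligations of the release operators, where a new obligation replaces a released one. -/
def releaseOblig (σ : SDTrace AP) (O L : ℕ → Prop) : ℕ → Prop
  | 0 => O 0 ∧ σ.IsOpen 0
  | i + 1 => (releaseOblig σ O L i ∧ ¬ L i) ∨ (O i ∧ ¬ σ.IsOpen i) ∨
      (O (i + 1) ∧ σ.IsOpen (i + 1))

variable {r : TimeRel} (hr : r = .ge ∨ r = .gt) (hP : σ.Const P A) (hQ : σ.Const Q B)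
    (hO : σ.Const (σ.ReleaseAt r n P Q) O)
include hr hP hQ hO

/-- The distance between the outer ends is approached by actual points. If it exceeds `n` strictly,
a point near the left end of `i` requires `B`, or a release, at a point near the right end of `j`.
-/
theorem release_of_le {i j : ℕ} (h : O i) (hij : i ≤ j)
    (hT : σ.hi j - σ.lo i > n) (hB : ¬ B j) :
    (∃ m, i ≤ m ∧ m < j ∧ A m) ∨ (σ.IsOpen j ∧ A j) := by
  obtain ⟨t, ht, htj⟩ := exists_mem_lt i (x := σ.hi j - n) (by linarith)
  obtain ⟨u, hu, huj⟩ := exists_mem_gt j (x := t + n) (by linarith)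
  have hn : (0 : ℝ) ≤ n := n.cast_nonneg
  have he : Earlier i t j u := hij.lt_or_eq.imp id fun e => ⟨e, by linarith⟩
  have hr' : r.Holds (u - t) n := by
    rcases hr with rfl | rfl <;> simp only [TimeRel.Holds] <;> linarith
  rcases ReleaseAt.index hP hQ ((hO i t ht).2 h) ht hu he hr' hB with ⟨m, h1, h2, h3⟩ | h1 | h1
  · exact .inl ⟨m, h1.le, h2, h3⟩
  · rcases hij.eq_or_lt with rfl | hlt
    · exact .inr h1
    · exact .inl ⟨i, le_rfl, hlt, h1.2⟩
  · exact .inr h1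

/-- A singleton start attains its left end, so for `≥` equality also counts when `j` is a singleton.
No releasing point lies in the starting interval, so the search begins at `i + 1`. -/
theorem release_of_not_open {i j : ℕ} (h : O i) (ho : ¬ σ.IsOpen i) (hij : i < j)
    (hT : ReleaseTiming r n (σ.hi j - σ.lo i) False (σ.IsOpen j)) (hB : ¬ B j) :
    (∃ m, i + 1 ≤ m ∧ m < j ∧ A m) ∨ (σ.IsOpen j ∧ A j) := by
  have ht : σ.lo i ∈ σ.interval i := (mem_interval_of_not_open ho).2 rfl
  obtain ⟨u, hu, hr'⟩ : ∃ u ∈ σ.interval j, r.Holds (u - σ.lo i) n := by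
    have far : σ.hi j - σ.lo i > n → ∃ u ∈ σ.interval j, r.Holds (u - σ.lo i) n := by
      intro h
      obtain ⟨u, hu, huj⟩ := exists_mem_gt j (x := σ.lo i + n) (by linarith)
      refine ⟨u, hu, ?_⟩
      rcases hr with rfl | rfl <;> simp only [TimeRel.Holds] <;> linarith
    rcases hr with rfl | rfl
    · rcases hT with hT | ⟨-, h1, h2⟩
      · exact far hT
      · exact ⟨_, (mem_interval_of_not_open h1).2 rfl, by rwa [hi_eq_lo h1] at h2⟩
    · exact far hT
  rcases ReleaseAt.index hP hQ ((hO i _ ht).2 h) ht hu (.inl hij) hr' hB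
    with ⟨m, h1, h2, h3⟩ | h1 | h1
  · exact .inl ⟨m, h1, h2, h3⟩
  · exact absurd h1.1 ho
  · exact .inr h1

/-- `L` stands for the operand variable, which decides whether an obligation counts as released.
While an older obligation is unreleased its clock is kept: its demands start earlier and the trace
satisfies them. Once `L` ends it, only the formula at the current singleton or at the next open
interval needs to justify further demands. -/
theorem releaseLower_exists {L : ℕ → Prop} (hL : ∀ i, A i → L i) :
    ∃ (c : ℕ → ℝ) (lo ob : ℕ → Prop), (∀ i, 0 ≤ c i) ∧ c 0 = 0 ∧ ¬ lo 0 ∧ ∀ i,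
      (O i → σ.IsOpen i → ob i) ∧ (O i → ¬ σ.IsOpen i → ob (i + 1)) ∧
      (ob i → L i ∨ ob (i + 1)) ∧
      (ob i → ReleaseTiming r n (c i + σ.dur i) (lo i) (σ.IsOpen i) →
        (L i ∧ σ.IsOpen i) ∨ B i) ∧
      (O i → σ.dur i > n → L i ∨ B i) ∧
      (¬ σ.IsOpen i ∧ ob i ∧ L i ∧ O i → c (i + 1) = 0 ∧ ¬ lo (i + 1)) ∧
      (O (i + 1) ∧ (¬ ob i ∨ L i) ∧ (σ.IsOpen i ∨ ¬ O i) →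
        c (i + 1) = 0 ∧ (lo (i + 1) ↔ σ.IsOpen (i + 1))) ∧
      (¬ (O (i + 1) ∧ (¬ ob i ∨ L i) ∧ (σ.IsOpen i ∨ ¬ O i)) ∧
        ¬ (¬ σ.IsOpen i ∧ ob i ∧ L i ∧ O i) →
        c (i + 1) = c i + σ.dur i ∧ (lo (i + 1) ↔ lo i)) := by
  set ob := releaseOblig σ O L with hob
  set D : ℕ → Prop := fun i => ¬ σ.IsOpen i ∧ ob i ∧ L i ∧ O i with hD
  set R : ℕ → Prop := fun i => O (i + 1) ∧ (¬ ob i ∨ L i) ∧ (σ.IsOpen i ∨ ¬ O i) with hR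
  have hDR : ∀ i, R i → ¬ D i := fun i h h' => h.2.2.elim h'.1 fun h => h h'.2.2.2
  set c := clockSeq 0 σ.dur (fun i => R i ∨ D i) with hc
  set lo := flagSeq (fun i => R i ∧ σ.IsOpen (i + 1)) (fun i => R i ∨ D i) with hlo
  have cD : ∀ i, D i → c (i + 1) = 0 ∧ ¬ lo (i + 1) := fun i h =>
    ⟨clockSeq_reset (R := fun i => R i ∨ D i) (.inr h), fun h' =>
      hDR i ((flagSeq_reset (R := fun i => R i ∨ D i) (.inr h)).1 h').1 h⟩
  have cR : ∀ i, R i → c (i + 1) = 0 ∧ (lo (i + 1) ↔ σ.IsOpen (i + 1)) := fun i h =>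
    ⟨clockSeq_reset (R := fun i => R i ∨ D i) (.inl h),
      (flagSeq_reset (R := fun i => R i ∨ D i) (.inl h)).trans (and_iff_right h)⟩
  have cA : ∀ i, ¬ R i → ¬ D i → c (i + 1) = c i + σ.dur i ∧ (lo (i + 1) ↔ lo i) :=
    fun i h h' => ⟨clockSeq_advance (R := fun i => R i ∨ D i) (not_or.2 ⟨h, h'⟩),
      flagSeq_advance (R := fun i => R i ∨ D i) (not_or.2 ⟨h, h'⟩)⟩
  -- The obligation of a singleton becomes active only at the next index. If nothing was pending,
  -- the clock was reset on entering the singleton, or has its initial value, and the passage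
  -- through it adds no time.
  have fresh : ∀ i, O i → ¬ σ.IsOpen i → ¬ ob i → c i = 0 ∧ ¬ lo i := by
    intro i h ho hn
    cases i with
    | zero => exact ⟨rfl, id⟩
    | succ i =>
      have hn' : ¬ ((ob i ∧ ¬ L i) ∨ (O i ∧ ¬ σ.IsOpen i) ∨
        (O (i + 1) ∧ σ.IsOpen (i + 1))) := hn
      obtain ⟨h1, h2⟩ := cR i ⟨h, by tauto, by tauto⟩
      exact ⟨h1, fun h => ho (h2.1 h)⟩
  have inv : ∀ i, ob i → ∀ j, i ≤ j →
      ReleaseTiming r n (c i + (σ.hi j - σ.lo i)) (lo i) (σ.IsOpen j) → ¬ B j →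
      (∃ m, i ≤ m ∧ m < j ∧ A m) ∨ (σ.IsOpen j ∧ A j) := by
    intro i
    induction i with
    | zero => exact fun h => absurd h.2 not_open_zero
    | succ i ih =>
      intro h j hij hT hB
      have hlo' := lo_add_dur (σ := σ) i
      -- The three sources of an obligation at `i + 1`: an unreleased older one, where the clock
      -- runs on; the singleton `i`, where it is zero by a delayed reset or by `fresh`; and the open
      -- interval `i + 1` itself, where it has just been reset.
      by_cases ha : ob i ∧ ¬ L i
      · obtain ⟨h1, h2⟩ := cA i (fun h => h.2.1.elim (fun h => h ha.1) ha.2) fun h => ha.2 h.2.2.1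
        rw [ReleaseTiming.congr h2, h1] at hT
        refine (ih ha.1 j (by omega) (by convert hT using 1; linarith) hB).imp_left ?_
        rintro ⟨m, h1, h2, h3⟩
        exact ⟨m, Nat.succ_le_of_lt (lt_of_le_of_ne h1 fun e => ha.2 (e ▸ hL _ h3)), h2, h3⟩
      by_cases hb : O i ∧ ¬ σ.IsOpen i
      · have hc1 : c (i + 1) = 0 ∧ ¬ lo (i + 1) := by
          by_cases hobi : ob i
          · exact cD i ⟨hb.2, hobi, by tauto, hb.1⟩
          · obtain ⟨h1, h2⟩ := cA i (fun h => h.2.2.elim hb.2 fun h => h hb.1) fun h => hobi h.2.1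
            obtain ⟨h3, h4⟩ := fresh i hb.1 hb.2 hobi
            exact ⟨by rw [h1, h3, dur, hi_eq_lo hb.2, sub_self, zero_add], by rwa [h2]⟩
        rw [ReleaseTiming.congr (iff_false_intro hc1.2), hc1.1, zero_add, σ.lo_succ,
          hi_eq_lo hb.2] at hT
        exact release_of_not_open hr hP hQ hO hb.1 hb.2 hij hT hB
      · have hc' : O (i + 1) ∧ σ.IsOpen (i + 1) := (h.resolve_left ha).resolve_left hb
        obtain ⟨h1, h2⟩ := cR i ⟨hc'.1, by tauto, by tauto⟩
        rw [ReleaseTiming.congr h2, h1, zero_add] at hT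
        refine release_of_le hr hP hQ hO hc'.1 hij ?_ hB
        -- The flag is set because `i + 1` is open. This excludes the equality case of `≥`, as a
        -- left end that is not attained requires.
        rcases hr with rfl | rfl
        · exact hT.elim id fun h => absurd hc'.2 h.1
        · exact hT
  refine ⟨c, lo, ob, clockSeq_nonneg le_rfl dur_nonneg, rfl, id, fun i => ⟨?_, ?_, ?_, ?_, ?_,
    cD i, cR i, fun h => cA i h.1 h.2⟩⟩
  · intro h ho
    cases i with
    | zero => exact ⟨h, ho⟩
    | succ i => exact .inr (.inr ⟨h, ho⟩)
  · exact fun h ho => .inr (.inl ⟨h, ho⟩)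
  · exact fun h => or_iff_not_imp_left.2 fun hl => .inl ⟨h, hl⟩
  · intro h hT
    refine or_iff_not_imp_right.2 fun hB => ?_
    rcases inv i h i le_rfl hT hB with ⟨m, h1, h2, -⟩ | h1
    · omega
    · exact ⟨hL _ h1.2, h1.1⟩
  · intro h hd
    refine or_iff_not_imp_right.2 fun hB => ?_
    have ho : σ.IsOpen i := dur_pos.1 (n.cast_nonneg.trans_lt hd)
    rcases release_of_le hr hP hQ hO h le_rfl hd hB with ⟨m, h1, h2, -⟩ | h1
    · omega
    · exact hL _ h1.2

end ReleaseLower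

end SDTrace

/-! ## Extending runs by values of new variables -/

section Join

variable {Z N : Type} {dom : Z → Type} {ndom : N → Type} {X NX : Type}

/-- A valuation of the old and the new non-clock variables. -/
def Val.join (v : Val dom) (w : Val ndom) : Val (Sum.elim dom ndom) := fun z =>
  match z with
  | .inl z => v z
  | .inr z => w z

/-- A state that gives values to the old and the new variables. -/
def State.join (s : State dom X) (w : Val ndom) (c : NX → ℝ) :
    State (Sum.elim dom ndom) (X ⊕ NX) :=
  ⟨s.disc.join w, Sum.elim s.clk c⟩

end Join

theorem MITL.mem_sub {AP : Type u} (φ : MITL AP) : φ ∈ φ.sub := by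
  cases φ <;> simp [MITL.sub]

theorem TransitionSystem.Run.HasTrace.dur_eq {AP : Type u} {S : TransitionSystem AP} {τ : S.Run}
    {σ : SDTrace AP} (h : τ.HasTrace σ) (i : ℕ) : τ.dur i = σ.dur i := by
  rw [SDTrace.dur, (h i).2.2]
  ring

/-! ### Completeness of an encoding extended by an increment -/

namespace Encoding

variable {AP : Type u} {S : TransitionSystem AP}

theorem base_completeFor : (Encoding.base S).CompleteFor ∅ :=
  ⟨Set.empty_subset _, fun _ ⟨τ, hτ⟩ _ => ⟨τ, hτ, fun _ h => h.elim⟩⟩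

/-- It suffices to be complete for a larger set of formulas with the same subformulas. -/
theorem CompleteFor.anti {E : Encoding S} {Φ Ψ : Set (MITL AP)} (h : E.CompleteFor Φ)
    (hΨ : Ψ ⊆ Φ) (hsub : ∀ φ ∈ Φ, ∃ ψ ∈ Ψ, φ.sub ⊆ ψ.sub) : E.CompleteFor Ψ := by
  obtain ⟨hΦ, h⟩ := h
  refine ⟨hΨ.trans hΦ, fun σ hσ hf => ?_⟩
  obtain ⟨τ, hτ, hs⟩ := h σ hσ fun φ hφ => by
    obtain ⟨ψ, hψ, hle⟩ := hsub φ hφ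
    exact fun χ hχ => hf ψ hψ χ (hle hχ)
  exact ⟨τ, hτ, fun φ hφ => hs φ (hΨ hφ)⟩

/-- The variable `⟦φ⟧` is true in the run `τ` wherever `φ` holds on the trace `σ`. -/
def SoundAt (E : Encoding S) (τ : E.sys.Run) (σ : SDTrace AP) (φ : MITL AP)
    (hφ : φ ∈ E.formulas) : Prop :=
  ∀ i, ∀ t ∈ σ.interval i, σ.Sat φ i t → (E.enc φ hφ).IsTrue (τ.state i).disc

/-- An extended encoding is complete if every suitable run can be extended by values of the new
variables. -/
theorem CompleteFor.add {E : Encoding S} {Φ : Set (MITL AP)} (h : E.CompleteFor Φ) {φ : MITL AP}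
    {N : E.sys.Increment} {out : BoolVar (Sum.elim E.sys.dom N.dom)}
    {hφ : φ.sub ⊆ insert φ E.formulas}
    (H : ∀ (σ : SDTrace AP) (τ : E.sys.Run), σ.Fine φ → τ.HasTrace σ →
      (∀ ψ (hψ : ψ ∈ E.formulas), ψ ∈ Φ → E.SoundAt τ σ ψ hψ) →
      ∃ (w : ℕ → Val N.dom) (c : ℕ → N.X → ℝ), (∀ i x, 0 ≤ c i x) ∧
        ((τ.state 0).join (w 0) (c 0)).Sat N.init ∧
        (∀ i, TransSat ((τ.state i).join (w i) (c i)) (σ.dur i)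
          ((τ.state (i + 1)).join (w (i + 1)) (c (i + 1))) N.trans) ∧
        (∀ f ∈ N.fair, ∀ m, ∃ i, m ≤ i ∧ f ((τ.state i).disc.join (w i))) ∧
        ∀ i, ∀ t ∈ σ.interval i, σ.Sat φ i t → out.IsTrue ((τ.state i).disc.join (w i))) :
    (E.add φ N out hφ).CompleteFor (insert φ Φ) := by
  obtain ⟨hΦ, h⟩ := h
  refine ⟨Set.insert_subset_insert hΦ, fun σ hσ hf => ?_⟩
  obtain ⟨τ, hτ, hs⟩ := h σ hσ fun ψ hψ => hf ψ (.inr hψ)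
  obtain ⟨w, c, hc, hi, ht, hfair, hout⟩ := H σ τ (hf φ (.inl rfl)) hτ fun ψ _ hψ => hs ψ hψ
  refine ⟨{
    state := fun i => (τ.state i).join (w i) (c i)
    dur := τ.dur
    dur_zero := τ.dur_zero
    dur_nonneg := τ.dur_nonneg
    clk_nonneg := fun i x => x.rec (τ.clk_nonneg i) (hc i)
    dur_succ := τ.dur_succ
    init := ⟨(StateSat_lift _ _).2 τ.init, hi⟩
    inv := fun i => (StateSat_lift _ _).2 (τ.inv i)
    trans := fun i => ⟨(TransSat_lift _ _ _ _).2 (τ.trans i), hτ.dur_eq i ▸ ht i⟩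
    fair := ?_ }, hτ, ?_⟩
  · intro f hf m
    rcases List.mem_append.1 hf with hf | hf
    · obtain ⟨g, hg, rfl⟩ := List.mem_map.1 hf
      exact τ.fair g hg m
    · exact hfair f hf m
  · intro ψ hψ i t hti hsat
    by_cases e : ψ = φ
    · subst e
      have he : (E.add ψ N out hφ).enc ψ (.inl rfl) = out := dif_pos rfl
      exact (congrArg (fun b => BoolVar.IsTrue b ((τ.state i).disc.join (w i))) he).mpr
        (hout i t hti hsat)
    · have hψ' := hψ.resolve_left e
      have he : (E.add φ N out hφ).enc ψ (.inr (hΦ hψ')) =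
        (E.enc ψ (hΦ hψ')).lift N.dom := dif_neg e
      exact (congrArg (fun b => BoolVar.IsTrue b ((τ.state i).disc.join (w i))) he).mpr
        (hs ψ hψ' i t hti hsat)

end Encoding

/-! ## Values of the auxiliary variables -/

section AuxState

variable {Z : Type} {dom : Z → Type} {X NX : Type} {A : Finset Aux}

open Classical in
/-- The state `s` with the truth values `V` of the auxiliary variables and the values `c` of the new
clocks. -/
noncomputable def State.withAux (A : Finset Aux) (s : State dom X) (V : Aux → Prop) (c : NX → ℝ) :
    State (Sum.elim dom fun _ : AuxVars A => Bool) (X ⊕ NX) :=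
  s.join (fun a => decide (V a.1)) c

variable (s : State dom X) (V : Aux → Prop) (c : NX → ℝ)

theorem State.isTrue_aux_withAux {a : Aux} (h : a ∈ A) :
    (BoolVar.aux a h).IsTrue (s.withAux A V c).disc ↔ V a := by
  classical exact decide_eq_true_iff

theorem State.isTrue_operand_withAux (b : BoolVar dom) :
    b.operand.IsTrue (s.withAux A V c).disc ↔ b.IsTrue s.disc := Iff.rfl

theorem State.old_disc_withAux : Val.old (s.withAux A V c).disc = s.disc := rfl

theorem State.clk_withAux (x : NX) : (s.withAux A V c).clk (Sum.inr x) = c x := rfl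

end AuxState

namespace Encoding

variable {AP : Type u} {S : TransitionSystem AP} {E : Encoding S} {Φ : Set (MITL AP)}

/-- Values are chosen for every name in `Aux`, and only those in `A` become variables. A default
branch in the choice of `V` is therefore harmless for names outside `A`. -/
theorem CompleteFor.add_bool (h : E.CompleteFor Φ) {φ : MITL AP} {A : Finset Aux}
    {trans : TransFormula (Sum.elim E.sys.dom (fun _ : AuxVars A => Bool)) (E.sys.X ⊕ Empty)}
    {fair : List (Val (Sum.elim E.sys.dom (fun _ : AuxVars A => Bool)) → Prop)}
    {ho : Aux.out ∈ A} {hφ : φ.sub ⊆ insert φ E.formulas}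
    (H : ∀ (σ : SDTrace AP) (τ : E.sys.Run), σ.Fine φ → τ.HasTrace σ →
      (∀ ψ (hψ : ψ ∈ E.formulas), ψ ∈ Φ → ∀ i, σ.truth ψ i →
        (E.enc ψ hψ).IsTrue (τ.state i).disc) →
      ∃ V : ℕ → Aux → Prop,
        (∀ i, TransSat ((τ.state i).withAux A (V i) Empty.elim) (σ.dur i)
          ((τ.state (i + 1)).withAux A (V (i + 1)) Empty.elim) trans) ∧
        (∀ f ∈ fair, ∀ m, ∃ i, m ≤ i ∧
          f ((τ.state i).withAux A (V i) (Empty.elim : Empty → ℝ)).disc) ∧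
        ∀ i, σ.truth φ i → V i .out) :
    (E.add φ (E.sys.boolIncrement A trans fair) (.aux .out ho) hφ).CompleteFor (insert φ Φ) := by
  classical
  refine h.add fun σ τ hf hτ hs => ?_
  obtain ⟨V, h1, h2, h3⟩ := H σ τ hf hτ fun ψ hψ hm i ⟨t, ht, hsat⟩ => hs ψ hψ hm i t ht hsat
  exact ⟨fun i a => decide (V i a.1), fun _ => Empty.elim, fun _ x => x.elim, trivial, h1, h2,
    fun i t ht hsat => decide_eq_true_iff.2 (h3 i ⟨t, ht, hsat⟩)⟩

theorem CompleteFor.add_clock (h : E.CompleteFor Φ) {φ : MITL AP} {A : Finset Aux}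
    {init : StateFormula (Sum.elim E.sys.dom (fun _ : AuxVars A => Bool)) (E.sys.X ⊕ Unit)}
    {trans : TransFormula (Sum.elim E.sys.dom (fun _ : AuxVars A => Bool)) (E.sys.X ⊕ Unit)}
    {fair : List (Val (Sum.elim E.sys.dom (fun _ : AuxVars A => Bool)) → Prop)}
    {clocks : ∀ (s : State (Sum.elim E.sys.dom (fun _ : AuxVars A => Bool)) (E.sys.X ⊕ Unit))
      (δ : ℝ) (s' : State (Sum.elim E.sys.dom (fun _ : AuxVars A => Bool)) (E.sys.X ⊕ Unit)),
      TransSat s δ s' trans →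
      s'.clk (Sum.inr ()) = 0 ∨ s'.clk (Sum.inr ()) = s.clk (Sum.inr ()) + δ}
    {ho : Aux.out ∈ A} {hφ : φ.sub ⊆ insert φ E.formulas}
    (H : ∀ (σ : SDTrace AP) (τ : E.sys.Run), σ.Fine φ → τ.HasTrace σ →
      (∀ ψ (hψ : ψ ∈ E.formulas), ψ ∈ Φ → ∀ i, σ.truth ψ i →
        (E.enc ψ hψ).IsTrue (τ.state i).disc) →
      ∃ (V : ℕ → Aux → Prop) (c : ℕ → ℝ), (∀ i, 0 ≤ c i) ∧
        ((τ.state 0).withAux A (V 0) fun _ => c 0).Sat init ∧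
        (∀ i, TransSat ((τ.state i).withAux A (V i) fun _ => c i) (σ.dur i)
          ((τ.state (i + 1)).withAux A (V (i + 1)) fun _ => c (i + 1)) trans) ∧
        (∀ f ∈ fair, ∀ m, ∃ i, m ≤ i ∧
          f ((τ.state i).withAux A (V i) fun _ : Unit => c i).disc) ∧
        ∀ i, σ.truth φ i → V i .out) :
    (E.add φ (E.sys.clockIncrement A init trans fair clocks) (.aux .out ho) hφ).CompleteFor
      (insert φ Φ) := by
  classical
  refine h.add fun σ τ hf hτ hs => ?_
  obtain ⟨V, c, h0, h1, h2, h3, h4⟩ :=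
    H σ τ hf hτ fun ψ hψ hm i ⟨t, ht, hsat⟩ => hs ψ hψ hm i t ht hsat
  exact ⟨fun i a => decide (V i a.1), fun i _ => c i, fun i _ => h0 i, h1, h2, h3,
    fun i t ht hsat => decide_eq_true_iff.2 (h4 i ⟨t, ht, hsat⟩)⟩

end Encoding

theorem BForm.eval_ite_tru {A : Type*} {p : Prop} [Decidable p] (f : BForm A) (v : A → Prop) :
    (if p then f else .tru).eval v ↔ (p → f.eval v) := by
  split_ifs with h <;> simp [h, BForm.eval]

/-! ### Completeness of the individual encodings -/

namespace Encoding

open Constraints SDTrace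

variable {AP : Type u} {S : TransitionSystem AP} {E : Encoding S} {Φ : Set (MITL AP)}

theorem CompleteFor.addAtom (h : E.CompleteFor Φ) (p : AP) :
    (E.addAtom p).CompleteFor (insert (.atom p) Φ) := by
  refine h.add_bool fun σ τ _ hτ _ => ⟨fun i _ => E.sys.ap p (τ.state i).disc, fun i => ?_,
    by simp, fun i ⟨t, _, hsat⟩ => ?_⟩
  · simp only [TransSat, BForm.eval, TransAtom.eval, now, State.isTrue_aux_withAux,
      State.old_disc_withAux]
  · have h : p ∈ σ.val i := hsat
    rwa [(hτ i).1] at h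

theorem CompleteFor.addNatom (h : E.CompleteFor Φ) (p : AP) :
    (E.addNatom p).CompleteFor (insert (.natom p) Φ) := by
  refine h.add_bool fun σ τ _ hτ _ => ⟨fun i _ => ¬ E.sys.ap p (τ.state i).disc, fun i => ?_,
    by simp, fun i ⟨t, _, hsat⟩ => ?_⟩
  · simp only [TransSat, BForm.eval, TransAtom.eval, now, State.isTrue_aux_withAux,
      State.old_disc_withAux]
  · have h : p ∉ σ.val i := hsat
    rwa [(hτ i).1] at h

theorem CompleteFor.addUn_evLeZero (h : E.CompleteFor Φ) {α : MITL AP}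
    (hα : α ∈ E.formulas) (hm : α ∈ Φ) :
    (E.addUn (.evLeZero) α hα).CompleteFor (insert (UnOp.apply (.evLeZero) α) Φ) := by
  refine h.add_bool fun σ τ hf _ hs => ?_
  have hφ := hf.const (MITL.mem_sub _)
  have hB := hf.const (ψ := α) (.inr α.mem_sub)
  refine ⟨fun i a => match a with
    | .out => σ.truth (.ev .le 0 α) i
    | _ => σ.IsOpen i, fun i => ?_, by simp, fun _ => id⟩
  simp only [TransSat, evZero, BForm.conj, BForm.eval, TransAtom.eval, now, nxt, isOpen, durGt,
    ClockRel.Holds, Nat.cast_zero, gt_iff_lt, dur_pos, State.isTrue_aux_withAux,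
    State.isTrue_operand_withAux]
  refine ⟨trivial, fun h => ?_, trivial⟩
  obtain ⟨h1, h2, h3⟩ := ev_zero hB hφ h
  exact ⟨h1, h2, h3.imp_left (hs α hα hm _)⟩

theorem CompleteFor.addUn_evLt (h : E.CompleteFor Φ) {n : ℕ} {hn : 0 < n} {α : MITL AP}
    (hα : α ∈ E.formulas) (hm : α ∈ Φ) :
    (E.addUn (.evLt n hn) α hα).CompleteFor (insert (UnOp.apply (.evLt n hn) α) Φ) := by
  refine h.add_clock fun σ τ hf _ hs => ?_
  have hφ := hf.const (MITL.mem_sub _)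
  have hB := hf.const (ψ := α) (.inr α.mem_sub)
  -- The overapproximation `R` is the value of the operand variable in the run, so that the resets
  -- agree with the constraint literally.
  obtain ⟨c, lo, hc, hc0, hlo0, H⟩ := ev_exists (.inl rfl) hB hφ (hs α hα hm)
  refine ⟨fun i a => match a with
    | .out => σ.truth (.ev .lt n α) i
    | .lefto => lo i
    | _ => σ.IsOpen i, c, hc, ?_, fun i => ?_, by simp, fun _ => id⟩
  · simp [State.Sat, initZero, BForm.eval, StateAtom.eval, ClockRel.Holds,
      State.isTrue_aux_withAux, State.clk_withAux, hc0, hlo0]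
  · obtain ⟨h1, h2, h3⟩ := H i
    simp only [TransSat, ev, evReset, evLtTiming, elapsed, BForm.conj, BForm.eval, TransAtom.eval,
      now, nxt, isOpen, durGt, ClockRel.Holds, Nat.cast_zero, gt_iff_lt, dur_pos, reset, advance,
      State.clk_withAux, State.isTrue_aux_withAux, State.isTrue_operand_withAux]
    refine ⟨trivial, fun h => ?_, fun h => ?_, h1, h2, h3, trivial⟩
    · exact (ev_succ (.inl rfl) hB hφ h.1).imp (fun h => hs α hα hm _ h.2)
        (Or.imp_left (hs α hα hm _))
    · exact ((ev_succ (.inl rfl) hB hφ h.1).resolve_left fun h' => h.2 h'.1).imp_left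
        (hs α hα hm _)

theorem CompleteFor.addUn_evLe (h : E.CompleteFor Φ) {n : ℕ} {hn : 0 < n} {α : MITL AP}
    (hα : α ∈ E.formulas) (hm : α ∈ Φ) :
    (E.addUn (.evLe n hn) α hα).CompleteFor (insert (UnOp.apply (.evLe n hn) α) Φ) := by
  refine h.add_clock fun σ τ hf _ hs => ?_
  have hφ := hf.const (MITL.mem_sub _)
  have hB := hf.const (ψ := α) (.inr α.mem_sub)
  obtain ⟨c, lo, hc, hc0, hlo0, H⟩ := ev_exists (.inr rfl) hB hφ (hs α hα hm)
  refine ⟨fun i a => match a with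
    | .out => σ.truth (.ev .le n α) i
    | .lefto => lo i
    | _ => σ.IsOpen i, c, hc, ?_, fun i => ?_, by simp, fun _ => id⟩
  · simp [State.Sat, initZero, BForm.eval, StateAtom.eval, ClockRel.Holds,
      State.isTrue_aux_withAux, State.clk_withAux, hc0, hlo0]
  · obtain ⟨h1, h2, h3⟩ := H i
    simp only [TransSat, ev, evReset, evLeTiming, elapsed, BForm.conj, BForm.eval, TransAtom.eval,
      now, nxt, isOpen, durGt, ClockRel.Holds, Nat.cast_zero, gt_iff_lt, dur_pos, reset, advance,
      State.clk_withAux, State.isTrue_aux_withAux, State.isTrue_operand_withAux]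
    refine ⟨trivial, fun h => ?_, fun h => ?_, h1, h2, h3, trivial⟩
    · exact (ev_succ (.inr rfl) hB hφ h.1).imp (fun h => hs α hα hm _ h.2)
        (Or.imp_left (hs α hα hm _))
    · exact ((ev_succ (.inr rfl) hB hφ h.1).resolve_left fun h' => h.2 h'.1).imp_left
        (hs α hα hm _)

theorem CompleteFor.addUn_alwLeZero (h : E.CompleteFor Φ) {α : MITL AP}
    (hα : α ∈ E.formulas) (hm : α ∈ Φ) :
    (E.addUn (.alwLeZero) α hα).CompleteFor (insert (UnOp.apply (.alwLeZero) α) Φ) := by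
  refine h.add_bool fun σ τ hf _ hs => ?_
  have hφ := hf.const (MITL.mem_sub _)
  have hB := hf.const (ψ := α) (.inr α.mem_sub)
  refine ⟨fun i a => match a with
    | .out => σ.truth (.alw .le 0 α) i
    | _ => σ.IsOpen i, fun i => ?_, by simp, fun _ => id⟩
  simp only [TransSat, alwZero, BForm.conj, BForm.eval, TransAtom.eval, now, nxt, isOpen, durGt,
    ClockRel.Holds, Nat.cast_zero, gt_iff_lt, dur_pos, State.isTrue_aux_withAux,
    State.isTrue_operand_withAux]
  exact ⟨trivial, fun h => (alw_zero hB hφ h).imp_right (Or.imp_right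
    (And.imp_left (hs α hα hm _))), trivial⟩

theorem CompleteFor.addUn_alwLt (h : E.CompleteFor Φ) {n : ℕ} {hn : 0 < n} {α : MITL AP}
    (hα : α ∈ E.formulas) (hm : α ∈ Φ) :
    (E.addUn (.alwLt n hn) α hα).CompleteFor (insert (UnOp.apply (.alwLt n hn) α) Φ) := by
  refine h.add_clock fun σ τ hf _ hs => ?_
  have hφ := hf.const (MITL.mem_sub _)
  have hB := hf.const (ψ := α) (.inr α.mem_sub)
  obtain ⟨c, ro, hc, H⟩ := alw_exists (.inl rfl) hn hB hφ
  refine ⟨fun i a => match a with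
    | .out => σ.truth (.alw .lt n α) i
    | _ => ro i, c, hc, trivial, fun i => ?_, by simp, fun _ => id⟩
  obtain ⟨h1, h2, h3⟩ := H i
  simp only [TransSat, alw, alwLtTiming, clock, BForm.conj, BForm.eval, TransAtom.eval, now, nxt,
    isOpen, durGt, ClockRel.Holds, Nat.cast_zero, gt_iff_lt, dur_pos, reset, advance,
    State.clk_withAux, State.isTrue_aux_withAux, State.isTrue_operand_withAux]
  exact ⟨fun h => hs α hα hm _ (h1 h), h2, h3, trivial⟩

theorem CompleteFor.addUn_alwLe (h : E.CompleteFor Φ) {n : ℕ} {hn : 0 < n} {α : MITL AP}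
    (hα : α ∈ E.formulas) (hm : α ∈ Φ) :
    (E.addUn (.alwLe n hn) α hα).CompleteFor (insert (UnOp.apply (.alwLe n hn) α) Φ) := by
  refine h.add_clock fun σ τ hf _ hs => ?_
  have hφ := hf.const (MITL.mem_sub _)
  have hB := hf.const (ψ := α) (.inr α.mem_sub)
  obtain ⟨c, ro, hc, H⟩ := alw_exists (.inr rfl) hn hB hφ
  refine ⟨fun i a => match a with
    | .out => σ.truth (.alw .le n α) i
    | _ => ro i, c, hc, trivial, fun i => ?_, by simp, fun _ => id⟩
  obtain ⟨h1, h2, h3⟩ := H i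
  simp only [TransSat, alw, alwLeTiming, clock, BForm.conj, BForm.eval, TransAtom.eval, now, nxt,
    isOpen, durGt, ClockRel.Holds, Nat.cast_zero, gt_iff_lt, dur_pos, reset, advance,
    State.clk_withAux, State.isTrue_aux_withAux, State.isTrue_operand_withAux]
  exact ⟨fun h => hs α hα hm _ (h1 h), h2, h3, trivial⟩

theorem CompleteFor.addBin_and (h : E.CompleteFor Φ) {α β : MITL AP}
    (hα : α ∈ E.formulas) (hβ : β ∈ E.formulas) (hm : α ∈ Φ) (hm' : β ∈ Φ) :
    (E.addBin (.and) α β hα hβ).CompleteFor (insert (BinOp.apply (.and) α β) Φ) := by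
  refine h.add_bool fun σ τ hf _ hs => ?_
  have hl := hs α hα hm
  have hr := hs β hβ hm'
  -- The constraint is an equivalence with the operand variables, so the output must follow them and
  -- not the truth value of the formula.
  refine ⟨fun i _ => (E.enc α hα).IsTrue (τ.state i).disc ∧ (E.enc β hβ).IsTrue (τ.state i).disc,
    fun i => ?_, by simp, fun i ⟨t, ht, h⟩ => ⟨hl i ⟨t, ht, h.1⟩, hr i ⟨t, ht, h.2⟩⟩⟩
  simp only [TransSat, BForm.eval, TransAtom.eval, now, State.isTrue_aux_withAux,
    State.isTrue_operand_withAux]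

theorem CompleteFor.addBin_or (h : E.CompleteFor Φ) {α β : MITL AP}
    (hα : α ∈ E.formulas) (hβ : β ∈ E.formulas) (hm : α ∈ Φ) (hm' : β ∈ Φ) :
    (E.addBin (.or) α β hα hβ).CompleteFor (insert (BinOp.apply (.or) α β) Φ) := by
  refine h.add_bool fun σ τ hf _ hs => ?_
  have hl := hs α hα hm
  have hr := hs β hβ hm'
  refine ⟨fun i _ => (E.enc α hα).IsTrue (τ.state i).disc ∨ (E.enc β hβ).IsTrue (τ.state i).disc,
    fun i => ?_, by simp, fun i ⟨t, ht, h⟩ =>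
      h.imp (fun h => hl i ⟨t, ht, h⟩) fun h => hr i ⟨t, ht, h⟩⟩
  simp only [TransSat, BForm.eval, TransAtom.eval, now, State.isTrue_aux_withAux,
    State.isTrue_operand_withAux]

theorem CompleteFor.addBin_until (h : E.CompleteFor Φ) {α β : MITL AP}
    (hα : α ∈ E.formulas) (hβ : β ∈ E.formulas) (hm : α ∈ Φ) (hm' : β ∈ Φ) :
    (E.addBin (.until) α β hα hβ).CompleteFor (insert (BinOp.apply (.until) α β) Φ) := by
  refine h.add_bool fun σ τ hf _ hs => ?_
  have hl := hs α hα hm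
  have hr := hs β hβ hm'
  have hφ := hf.const (MITL.mem_sub _)
  have hA := hf.const (ψ := α) (.inr (.inl α.mem_sub))
  have hB := hf.const (ψ := β) (.inr (.inr β.mem_sub))
  refine ⟨fun i a => match a with
    | .out => σ.truth (.untl .ge 0 α β) i
    | _ => σ.IsOpen i, fun i => ?_, ?_, fun _ => id⟩
  · simp only [TransSat, untl, BForm.conj, BForm.eval, TransAtom.eval, now, nxt, isOpen, durGt,
      ClockRel.Holds, Nat.cast_zero, gt_iff_lt, dur_pos, State.isTrue_aux_withAux,
      State.isTrue_operand_withAux]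
    refine ⟨trivial, fun h => ?_, fun h => ?_, trivial⟩
    · exact (until_open hA hB hφ h.1 h.2).imp (hl _)
        (Or.imp (hr _) (Or.imp (hr _) (And.imp_left (hl _))))
    · exact (until_not_open hA hB hφ h.1 h.2).imp (And.imp_right (hr _)) (And.imp_left (hl _))
  · simp only [List.mem_singleton, forall_eq, State.isTrue_aux_withAux,
      State.isTrue_operand_withAux]
    exact fun m => (until_fair hB hφ m).imp fun i => And.imp_right (Or.imp_right (hr i))

theorem CompleteFor.addBin_untilGe (h : E.CompleteFor Φ) {n : ℕ} {hn : 0 < n} {α β : MITL AP}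
    (hα : α ∈ E.formulas) (hβ : β ∈ E.formulas) (hm : α ∈ Φ) (hm' : β ∈ Φ) :
    (E.addBin (.untilGe n hn) α β hα hβ).CompleteFor (insert (BinOp.apply (.untilGe n hn) α β) Φ) := by
  refine h.add_clock fun σ τ hf _ hs => ?_
  have hl := hs α hα hm
  have hr := hs β hβ hm'
  have hφ := hf.const (MITL.mem_sub _)
  have hA := hf.const (ψ := α) (.inr (.inl α.mem_sub))
  have hB := hf.const (ψ := β) (.inr (.inr β.mem_sub))
  obtain ⟨c, ro, ob, hc, hfair, H⟩ := untilLower_exists (.inl rfl) hA hB hφ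
  refine ⟨fun i a => match a with
    | .out => σ.truth (.untl .ge n α β) i
    | .oblig => ob i
    | .tim => UntilTiming .ge n (c i + σ.dur i) (ro i) (σ.IsOpen i)
    | .opn => σ.IsOpen i
    | _ => ro i, c, hc, trivial, fun i => ?_, ?_, fun _ => id⟩
  · obtain ⟨h1, h2, h3, h4, h5, h6⟩ := H i
    simp only [TransSat, untlLower, untlGeTiming, BForm.eval_ite_tru, elapsed, BForm.conj,
      BForm.eval, TransAtom.eval, now, nxt, isOpen, durGt, ClockRel.Holds, Nat.cast_zero, gt_iff_lt,
      dur_pos, reset, advance, State.clk_withAux, State.isTrue_aux_withAux,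
      State.isTrue_operand_withAux]
    refine ⟨trivial, Iff.rfl, h1, fun hn h => (h2 hn h).imp_right (hl _), fun h => ?_, fun h => ?_,
      h5, h6, trivial⟩
    · exact (h3 h.1 h.2).imp (hl _) (Or.imp (And.imp_left (hr _))
        (Or.imp (And.imp_left (hr _)) (And.imp_left (hl _))))
    · exact (h4 h.1 h.2).imp (And.imp_right (And.imp_left (hr _))) (And.imp_left (hl _))
  · simp only [List.mem_singleton, forall_eq, State.isTrue_aux_withAux,
      State.isTrue_operand_withAux]
    exact fun m => (hfair m).imp fun i => And.imp_right (Or.imp_right (hr i))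

theorem CompleteFor.addBin_untilGt (h : E.CompleteFor Φ) {n : ℕ} {α β : MITL AP}
    (hα : α ∈ E.formulas) (hβ : β ∈ E.formulas) (hm : α ∈ Φ) (hm' : β ∈ Φ) :
    (E.addBin (.untilGt n) α β hα hβ).CompleteFor (insert (BinOp.apply (.untilGt n) α β) Φ) := by
  refine h.add_clock fun σ τ hf _ hs => ?_
  have hl := hs α hα hm
  have hr := hs β hβ hm'
  have hφ := hf.const (MITL.mem_sub _)
  have hA := hf.const (ψ := α) (.inr (.inl α.mem_sub))
  have hB := hf.const (ψ := β) (.inr (.inr β.mem_sub))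
  obtain ⟨c, ro, ob, hc, hfair, H⟩ := untilLower_exists (.inr rfl) hA hB hφ
  refine ⟨fun i a => match a with
    | .out => σ.truth (.untl .gt n α β) i
    | .oblig => ob i
    | .tim => UntilTiming .gt n (c i + σ.dur i) (ro i) (σ.IsOpen i)
    | .opn => σ.IsOpen i
    | _ => ro i, c, hc, trivial, fun i => ?_, ?_, fun _ => id⟩
  · obtain ⟨h1, h2, h3, h4, h5, h6⟩ := H i
    simp only [TransSat, untlLower, untlGtTiming, BForm.eval_ite_tru, elapsed, BForm.conj,
      BForm.eval, TransAtom.eval, now, nxt, isOpen, durGt, ClockRel.Holds, Nat.cast_zero, gt_iff_lt,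
      dur_pos, reset, advance, State.clk_withAux, State.isTrue_aux_withAux,
      State.isTrue_operand_withAux]
    refine ⟨trivial, Iff.rfl, h1, fun hn h => (h2 hn h).imp_right (hl _), fun h => ?_, fun h => ?_,
      h5, h6, trivial⟩
    · exact (h3 h.1 h.2).imp (hl _) (Or.imp (And.imp_left (hr _))
        (Or.imp (And.imp_left (hr _)) (And.imp_left (hl _))))
    · exact (h4 h.1 h.2).imp (And.imp_right (And.imp_left (hr _))) (And.imp_left (hl _))
  · simp only [List.mem_singleton, forall_eq, State.isTrue_aux_withAux,
      State.isTrue_operand_withAux]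
    exact fun m => (hfair m).imp fun i => And.imp_right (Or.imp_right (hr i))

theorem CompleteFor.addBin_release (h : E.CompleteFor Φ) {α β : MITL AP}
    (hα : α ∈ E.formulas) (hβ : β ∈ E.formulas) (hm : α ∈ Φ) (hm' : β ∈ Φ) :
    (E.addBin (.release) α β hα hβ).CompleteFor (insert (BinOp.apply (.release) α β) Φ) := by
  refine h.add_bool fun σ τ hf _ hs => ?_
  have hl := hs α hα hm
  have hr := hs β hβ hm'
  have hφ := hf.const (MITL.mem_sub _)
  have hA := hf.const (ψ := α) (.inr (.inl α.mem_sub))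
  have hB := hf.const (ψ := β) (.inr (.inr β.mem_sub))
  obtain ⟨ob, H⟩ := release_exists hA hB hφ
  refine ⟨fun i a => match a with
    | .out => σ.truth (.release .ge 0 α β) i
    | _ => ob i, fun i => ?_, by simp, fun _ => id⟩
  obtain ⟨h1, h2, h3, h4⟩ := H i
  simp only [TransSat, release, BForm.conj, BForm.eval, TransAtom.eval, now, nxt, isOpen, durGt,
    ClockRel.Holds, Nat.cast_zero, gt_iff_lt, dur_pos, State.isTrue_aux_withAux,
    State.isTrue_operand_withAux]
  exact ⟨fun h => h1 h.1 h.2, fun h => h2 h.1 h.2, fun h => (h3 h).imp_left (hl _),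
    fun h => (h4 h).imp (And.imp_right (hl _)) (hr _), trivial⟩

theorem CompleteFor.addBin_releaseGe (h : E.CompleteFor Φ) {n : ℕ} {hn : 0 < n} {α β : MITL AP}
    (hα : α ∈ E.formulas) (hβ : β ∈ E.formulas) (hm : α ∈ Φ) (hm' : β ∈ Φ) :
    (E.addBin (.releaseGe n hn) α β hα hβ).CompleteFor (insert (BinOp.apply (.releaseGe n hn) α β) Φ) := by
  refine h.add_clock fun σ τ hf _ hs => ?_
  have hl := hs α hα hm
  have hr := hs β hβ hm'
  have hφ := hf.const (MITL.mem_sub _)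
  have hA := hf.const (ψ := α) (.inr (.inl α.mem_sub))
  have hB := hf.const (ψ := β) (.inr (.inr β.mem_sub))
  -- `L` is the value of the left operand's variable, because the reset and delay conditions test
  -- that variable.
  obtain ⟨c, lo, ob, hc, hc0, hlo0, H⟩ := releaseLower_exists (.inl rfl) hA hB hφ hl
  refine ⟨fun i a => match a with
    | .out => σ.truth (.release .ge n α β) i
    | .oblig => ob i
    | .lefto => lo i
    | _ => σ.IsOpen i, c, hc, ?_, fun i => ?_, by simp, fun _ => id⟩
  · simp [State.Sat, initZero, BForm.eval, StateAtom.eval, ClockRel.Holds,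
      State.isTrue_aux_withAux, State.clk_withAux, hc0, hlo0]
  · obtain ⟨h1, h2, h3, h4, h5, h6, h7, h8⟩ := H i
    simp only [TransSat, releaseLower, releaseDelay, releaseReset, releaseGeTiming, elapsed,
      BForm.conj, BForm.eval, TransAtom.eval, now, nxt, isOpen, durGt, ClockRel.Holds,
      Nat.cast_zero, gt_iff_lt, dur_pos, reset, advance, State.clk_withAux,
      State.isTrue_aux_withAux, State.isTrue_operand_withAux]
    exact ⟨trivial, fun h => h1 h.1 h.2, fun h => h2 h.1 h.2, h3,
      fun h => (h4 h.1 h.2).imp_right (hr _), fun h => (h5 h.1 h.2).imp_right (hr _),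
      h6, h7, h8, trivial⟩

theorem CompleteFor.addBin_releaseGt (h : E.CompleteFor Φ) {n : ℕ} {α β : MITL AP}
    (hα : α ∈ E.formulas) (hβ : β ∈ E.formulas) (hm : α ∈ Φ) (hm' : β ∈ Φ) :
    (E.addBin (.releaseGt n) α β hα hβ).CompleteFor (insert (BinOp.apply (.releaseGt n) α β) Φ) := by
  refine h.add_clock fun σ τ hf _ hs => ?_
  have hl := hs α hα hm
  have hr := hs β hβ hm'
  have hφ := hf.const (MITL.mem_sub _)
  have hA := hf.const (ψ := α) (.inr (.inl α.mem_sub))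
  have hB := hf.const (ψ := β) (.inr (.inr β.mem_sub))
  obtain ⟨c, lo, ob, hc, hc0, hlo0, H⟩ := releaseLower_exists (.inr rfl) hA hB hφ hl
  refine ⟨fun i a => match a with
    | .out => σ.truth (.release .gt n α β) i
    | .oblig => ob i
    | .lefto => lo i
    | _ => σ.IsOpen i, c, hc, ?_, fun i => ?_, by simp, fun _ => id⟩
  · simp [State.Sat, initZero, BForm.eval, StateAtom.eval, ClockRel.Holds,
      State.isTrue_aux_withAux, State.clk_withAux, hc0, hlo0]
  · obtain ⟨h1, h2, h3, h4, h5, h6, h7, h8⟩ := H i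
    simp only [TransSat, releaseLower, releaseDelay, releaseReset, releaseGtTiming, elapsed,
      BForm.conj, BForm.eval, TransAtom.eval, now, nxt, isOpen, durGt, ClockRel.Holds,
      Nat.cast_zero, gt_iff_lt, dur_pos, reset, advance, State.clk_withAux,
      State.isTrue_aux_withAux, State.isTrue_operand_withAux]
    exact ⟨trivial, fun h => h1 h.1 h.2, fun h => h2 h.1 h.2, h3,
      fun h => (h4 h.1 h.2).imp_right (hr _), fun h => (h5 h.1 h.2).imp_right (hr _),
      h6, h7, h8, trivial⟩

/-! ### All operators together -/

theorem CompleteFor.addUn (h : E.CompleteFor Φ) (o : UnOp) {α : MITL AP}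
    (hα : α ∈ E.formulas) (hm : α ∈ Φ) :
    (E.addUn o α hα).CompleteFor (insert (o.apply α) Φ) := by
  cases o with
  | evLeZero => exact h.addUn_evLeZero hα hm
  | evLt n hn => exact h.addUn_evLt hα hm
  | evLe n hn => exact h.addUn_evLe hα hm
  | alwLeZero => exact h.addUn_alwLeZero hα hm
  | alwLt n hn => exact h.addUn_alwLt hα hm
  | alwLe n hn => exact h.addUn_alwLe hα hm

theorem CompleteFor.addBin (h : E.CompleteFor Φ) (o : BinOp) {α β : MITL AP}
    (hα : α ∈ E.formulas) (hβ : β ∈ E.formulas) (hm : α ∈ Φ) (hm' : β ∈ Φ) :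
    (E.addBin o α β hα hβ).CompleteFor (insert (o.apply α β) Φ) := by
  match o with
  | .and => exact h.addBin_and hα hβ hm hm'
  | .or => exact h.addBin_or hα hβ hm hm'
  | .until => exact h.addBin_until hα hβ hm hm'
  | .untilGe n hn => exact h.addBin_untilGe hα hβ hm hm'
  | .untilGt n => exact h.addBin_untilGt hα hβ hm hm'
  | .release => exact h.addBin_release hα hβ hm hm'
  | .releaseGe n hn => exact h.addBin_releaseGe hα hβ hm hm'
  | .releaseGt n => exact h.addBin_releaseGt hα hβ hm hm'

theorem _root_.UnOp.sub_subset_apply (o : UnOp) (α : MITL AP) : α.sub ⊆ (o.apply α).sub := by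
  cases o <;> exact Set.subset_insert _ _

theorem _root_.BinOp.sub_subset_apply (o : BinOp) (α β : MITL AP) :
    α.sub ∪ β.sub ⊆ (o.apply α β).sub := by
  cases o <;> exact Set.subset_insert _ _

end Encoding

/-- Completeness of the encodings. The first part is about a complete encoding of exactly the
operands; the last part says that the encodings are also complete jointly with any set of formulas
`Φ` that is already jointly completely encoded, so that they can be iterated. -/
theorem mainTheorem2 {AP : Type u} (S : TransitionSystem AP) :
    (∀ p : AP, ((Encoding.base S).addAtom p).CompleteFor {.atom p}) ∧
    (∀ p : AP, ((Encoding.base S).addNatom p).CompleteFor {.natom p}) ∧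
    (∀ (E : Encoding S) (o : UnOp) (α : MITL AP) (hα : α ∈ E.formulas),
      E.CompleteFor {α} → (E.addUn o α hα).CompleteFor {o.apply α}) ∧
    (∀ (E : Encoding S) (o : BinOp) (α β : MITL AP) (hα : α ∈ E.formulas) (hβ : β ∈ E.formulas),
      E.CompleteFor {α, β} → (E.addBin o α β hα hβ).CompleteFor {o.apply α β}) ∧
    (∀ (E : Encoding S) (Φ : Set (MITL AP)), E.CompleteFor Φ →
      (∀ p : AP, (E.addAtom p).CompleteFor (insert (.atom p) Φ)) ∧
      (∀ p : AP, (E.addNatom p).CompleteFor (insert (.natom p) Φ)) ∧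
      (∀ (o : UnOp) (α : MITL AP) (hα : α ∈ E.formulas), α ∈ Φ →
        (E.addUn o α hα).CompleteFor (insert (o.apply α) Φ)) ∧
      (∀ (o : BinOp) (α β : MITL AP) (hα : α ∈ E.formulas) (hβ : β ∈ E.formulas),
        α ∈ Φ → β ∈ Φ →
        (E.addBin o α β hα hβ).CompleteFor (insert (o.apply α β) Φ))) := by
  have hbase := Encoding.base_completeFor (S := S)
  refine ⟨fun p => ?_, fun p => ?_, fun E o α hα h => ?_, fun E o α β hα hβ h => ?_,
    fun E Φ h => ⟨h.addAtom, h.addNatom, fun o α hα => h.addUn o hα,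
      fun o α β hα hβ => h.addBin o hα hβ⟩⟩
  · simpa using hbase.addAtom p
  · simpa using hbase.addNatom p
  -- The joint statement gives completeness for the operand together with the new formula. The
  -- operand may be dropped because its subformulas are among those of the new formula.
  · refine (h.addUn o hα rfl).anti (by simp) ?_
    rintro φ (rfl | rfl)
    · exact ⟨_, rfl, subset_rfl⟩
    · exact ⟨_, rfl, o.sub_subset_apply φ⟩
  · refine (h.addBin o hα hβ (.inl rfl) (.inr rfl)).anti (by simp) ?_
    have hsub := Set.union_subset_iff.1 (o.sub_subset_apply α β)
    rintro φ (rfl | rfl | rfl)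
    · exact ⟨_, rfl, subset_rfl⟩
    · exact ⟨_, rfl, hsub.1⟩
    · exact ⟨_, rfl, hsub.2⟩
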